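/- Let $k\ge 1$. A $k$-partite space is $\mathcal H=\mathcal H_1\otimes\dots\otimes\mathcal H_k$ with finite-dimensional complex Hilbert spaces $\mathcal H_i$; $\mathbb S(\mathcal H)$ is its set of unit vectors. For $\psi\in\mathcal H$, $\varphi\in\mathcal K$, the vectors $\psi\otimes\varphi$ and $\psi\oplus\varphi$ are regarded as $k$-partite vectors in $\bigotimes_i(\mathcal H_i\otimes\mathcal K_i)$ and $\bigotimes_i(\mathcal H_i\oplus\mathcal K_i)$, respectively; similarly for $\psi^{\otimes n}$ and $\psi_1\oplus\dots\oplus\psi_l$. Logarithms are to base $2$. *LOCC.* A remembering one-step LOCC channel maps an operator $\rho$ on $\mathcal H$ with classical register $\mathcal X$ to $\sum_{y\in\mathcal Y}\big((K_y)_i\otimes|y\rangle\langle f(y)|\big)\rho\big((K_y)_i^*\otimes|f(y)\rangle\langle y|\big)$, where $i\in\{1,\dots,k\}$, $\mathcal Y$ is a finite set, $f:\mathcal Y\to\mathcal X$, and the operators $K_y:\mathcal H_i\to\mathcal K_i$ of party $i$ satisfy $\sum_y K_y^*K_y\otimes|f(y)\rangle\langle f(y)|\le I$. For unit vectors $\psi\in\mathbb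 S(\mathcal H)$, $\psi_x\in\mathbb S(\mathcal K)$ and a probability distribution $P$ on a finite set $\mathcal X$, we write $$|\psi\rangle\langle\psi|\xrightarrow{\mathrm{LOCC}}\sum_{x\in\mathcal X}P(x)\,|\psi_x\rangle\langle\psi_x|\otimes|x\rangle\langle x|\qquad(*)$$ if the right-hand side is obtained from the left-hand side by a finite composition of such channels, followed by forgetting a part of the classical register. *Entanglement measures.* Let $E$ be a real function defined on the unit vectors of all $k$-partite spaces. We call $E$ * *subadditive* (*additive*) if $E(\psi_1\otimes\psi_2)\le E(\psi_1)+E(\psi_2)$ (respectively $=$) for all unit vectors $\psi_1,\psi_2$; * *logarithmically bounded* if $E(\psi_1\oplus\dots\oplus\psi_l)\le\max_{j}E(\psi_j/\|\psi_j\|)+\log l$ for all nonzero $\psi_1,\dots,\psi_l$ such that $\psi_1\oplus\dots\oplus\psi_l$ is a unit vector; * *monotone on average* if $E(\psi)\ge\sum_xP(x)E(\psi_x)$ whenever $(*)$ holds; * *weakly monotone* if $E(\psi)\ge P(x)E(\psi_x)$ for each $x\in\mathcal X$ whenever $(*)$ holds. Let $\mathcal F_{\mathrm{sub},k}$ be the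 set of those $E$ that are non-negative, subadditive, logarithmically bounded and monotone on average. The smoothing limit of $E\in\mathcal F_{\mathrm{sub},k}$ is $$\Phi(E)(\psi)=\lim_{\epsilon\to0^+}\limsup_{n\to\infty}\frac1n\inf\left\{E(\varphi):\varphi\in\mathbb S(\mathcal H^{\otimes n}),\ |\langle\varphi|\psi^{\otimes n}\rangle|^2\ge1-\epsilon\right\}\qquad(\psi\in\mathbb S(\mathcal H)).$$ **Proposition.** Let $E\in\mathcal F_{\mathrm{sub},k}$. Then $\Phi(E)$ is logarithmically bounded and weakly monotone. Furthermore, if $\Phi(E)$ is additive, then it is monotone on average. -/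

import Mathlib

noncomputable section

namespace Multipartite

open scoped ComplexOrder

variable {k : ℕ}

/-- A `k`-partite finite-dimensional Hilbert space `H₁ ⊗ ⋯ ⊗ H_k`, where the `i`-th local space is
`ℂ^(ι i)`, the space with an orthonormal basis labelled by the finite type `ι i`. -/
structure Space (k : ℕ) where
  ι : Fin k → Type
  fin : ∀ i, Fintype (ι i)

attribute [instance] Space.fin

/-- Labels of the product basis of `H₁ ⊗ ⋯ ⊗ H_k`. -/
abbrev Space.Idx (H : Space k) : Type := ∀ i, H.ι i

/-- Vectors of `H₁ ⊗ ⋯ ⊗ H_k`, given by their coefficients in the product basis. -/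
abbrev Space.Vec (H : Space k) : Type := EuclideanSpace ℂ H.Idx

/-- The set `𝕊(H)` of unit vectors of `H = H₁ ⊗ ⋯ ⊗ H_k`. -/
abbrev Space.Sphere (H : Space k) : Type := {v : H.Vec // ‖v‖ = 1}

/-- The unit vector `v / ‖v‖` of a nonzero vector `v`. -/
def normalize {H : Space k} (v : H.Vec) (hv : v ≠ 0) : H.Sphere :=
  ⟨((‖v‖ : ℂ)⁻¹) • v, by
    rw [norm_smul, norm_inv, Complex.norm_real, norm_norm]
    exact inv_mul_cancel₀ (norm_ne_zero_iff.mpr hv)⟩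

/-! ### Tensor products, tensor powers and direct sums -/

/-- `(H₁ ⊗ K₁) ⊗ ⋯ ⊗ (H_k ⊗ K_k)`. -/
def Space.tensor (H K : Space k) : Space k where
  ι i := H.ι i × K.ι i
  fin _ := inferInstance

/-- `H₁^{⊗ n} ⊗ ⋯ ⊗ H_k^{⊗ n}`. -/
def Space.pow (H : Space k) (n : ℕ) : Space k where
  ι i := Fin n → H.ι i
  fin _ := inferInstance

/-- `(⨁ⱼ H(j)₁) ⊗ ⋯ ⊗ (⨁ⱼ H(j)_k)`. -/
def Space.directSum {l : ℕ} (H : Fin l → Space k) : Space k where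
  ι i := Σ j, (H j).ι i
  fin _ := inferInstance

/-- The vector `v ⊗ w`. -/
def tensorVec {H K : Space k} (v : H.Vec) (w : K.Vec) : (H.tensor K).Vec :=
  WithLp.toLp 2 fun x => v (fun i => (x i).1) * w (fun i => (x i).2)

/-- The vector `v^{⊗ n}`. -/
def powVec {H : Space k} (v : H.Vec) (n : ℕ) : (H.pow n).Vec :=
  WithLp.toLp 2 fun x => ∏ m : Fin n, v (fun i => x i m)

open Classical in
/-- The vector `v₁ ⊕ ⋯ ⊕ v_l`, regarded as an element of the `k`-partite space
`(⨁ⱼ H(j)₁) ⊗ ⋯ ⊗ (⨁ⱼ H(j)_k)`: the coefficient of `vⱼ` at the product basis vector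
`(y₁, …, y_k)` becomes the coefficient at `((j, y₁), …, (j, y_k))`, all others are zero. -/
def directSumVec {l : ℕ} {H : Fin l → Space k} (v : ∀ j, (H j).Vec) :
    (Space.directSum H).Vec :=
  WithLp.toLp 2 fun x => ∑ j, ∑ y : (H j).Idx,
    if x = (fun i => (⟨j, y i⟩ : Σ j, (H j).ι i)) then v j y else 0

theorem norm_tensorVec {H K : Space k} (v : H.Vec) (w : K.Vec) :
    ‖tensorVec v w‖ = ‖v‖ * ‖w‖ := by
  have h : ‖tensorVec v w‖ ^ 2 = (‖v‖ * ‖w‖) ^ 2 := by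
    rw [mul_pow, EuclideanSpace.norm_sq_eq, EuclideanSpace.norm_sq_eq, EuclideanSpace.norm_sq_eq,
      Finset.sum_mul_sum, ← Fintype.sum_prod_type']
    refine Fintype.sum_equiv (Equiv.arrowProdEquivProdArrow (Fin k) H.ι K.ι) _ _ fun x => ?_
    simp [tensorVec, mul_pow, Equiv.arrowProdEquivProdArrow]
  exact (sq_eq_sq₀ (norm_nonneg _) (by positivity)).mp h

theorem norm_powVec {H : Space k} (v : H.Vec) (n : ℕ) : ‖powVec v n‖ = ‖v‖ ^ n := by
  have h : ‖powVec v n‖ ^ 2 = (‖v‖ ^ n) ^ 2 := by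
    rw [← pow_mul, mul_comm n 2, pow_mul, EuclideanSpace.norm_sq_eq, EuclideanSpace.norm_sq_eq,
      Fintype.sum_pow]
    refine Fintype.sum_equiv (Equiv.piComm fun (i : Fin k) (_ : Fin n) => H.ι i) _ _ fun x => ?_
    simp only [powVec, norm_prod, ← Finset.prod_pow]
    rfl
  exact (sq_eq_sq₀ (norm_nonneg _) (by positivity)).mp h

/-- `ψ ⊗ φ` for unit vectors. -/
def tensor {H K : Space k} (ψ : H.Sphere) (φ : K.Sphere) : (H.tensor K).Sphere :=
  ⟨tensorVec ψ.1 φ.1, by rw [norm_tensorVec, ψ.2, φ.2, one_mul]⟩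

/-- `ψ^{⊗ n}` for a unit vector. -/
def tpow {H : Space k} (ψ : H.Sphere) (n : ℕ) : (H.pow n).Sphere :=
  ⟨powVec ψ.1 n, by rw [norm_powVec, ψ.2, one_pow]⟩

/-! ### LOCC transformations -/

/-- Operators in `B(H₁) ⊗ ⋯ ⊗ B(H_k) ⊗ Diag(ℂ^X)`, i.e. block-diagonal operators
`∑ₓ ρ(x) ⊗ |x⟩⟨x|`, given by their blocks. -/
abbrev RegOp (H : Space k) (X : Type) : Type := X → Matrix H.Idx H.Idx ℂ

/-- The projector `|v⟩⟨v|`. -/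
def proj {H : Space k} (v : H.Vec) : Matrix H.Idx H.Idx ℂ :=
  Matrix.vecMulVec v (star (v : H.Idx → ℂ))

open Classical in
/-- The operator `I ⊗ ⋯ ⊗ A ⊗ ⋯ ⊗ I` with `A : Hᵢ → Kᵢ` acting on the `i`-th factor; the other
local spaces are the same up to the naming `e j` of the basis. -/
def localOp {H K : Space k} (i : Fin k) (e : ∀ j, j ≠ i → H.ι j ≃ K.ι j)
    (A : Matrix (K.ι i) (H.ι i) ℂ) : Matrix K.Idx H.Idx ℂ :=
  Matrix.of fun x y => if ∀ j (h : j ≠ i), x j = e j h (y j) then A (x i) (y i) else 0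

open Classical in
/-- `∑_y A_y^* A_y ⊗ |f(y)⟩⟨f(y)| ≤ I`, written block by block. -/
def IsKraus {a b X Y : Type} [Fintype a] [Fintype b] [Fintype Y]
    (f : Y → X) (A : Y → Matrix b a ℂ) : Prop :=
  ∀ x, (1 - ∑ y with f y = x, (A y).conjTranspose * A y).PosSemidef

/-- The remembering one-step map
`ρ ↦ ∑_y ((A_y)ᵢ ⊗ |y⟩⟨f(y)|) ρ ((A_y)ᵢ^* ⊗ |f(y)⟩⟨y|)`: party `i` reads the register value
`f(y)`, applies the operator `A_y`, and the new register value is `y`. -/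
def stepMap {H K : Space k} {X Y : Type} (i : Fin k) (e : ∀ j, j ≠ i → H.ι j ≃ K.ι j)
    (f : Y → X) (A : Y → Matrix (K.ι i) (H.ι i) ℂ) (ρ : RegOp H X) : RegOp K Y :=
  fun y => localOp i e (A y) * ρ (f y) * (localOp i e (A y)).conjTranspose

/-- Compositions `Λ_n ∘ ⋯ ∘ Λ₁` of remembering one-step LOCC channels. -/
inductive IsProtocol : (H K : Space k) → (X Y : Type) → (RegOp H X → RegOp K Y) → Prop
  | refl (H : Space k) (X : Type) : IsProtocol H H X X id
  | step {H K L : Space k} {X Y Z : Type} [Fintype Z] (Λ : RegOp H X → RegOp K Y)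
      (hΛ : IsProtocol H K X Y Λ) (i : Fin k) (e : ∀ j, j ≠ i → K.ι j ≃ L.ι j)
      (f : Z → Y) (A : Z → Matrix (L.ι i) (K.ι i) ℂ) (hA : IsKraus f A) :
      IsProtocol H L X Z (stepMap i e f A ∘ Λ)

open Classical in
/-- Forgetting a part of the classical register: only the value `g(y)` is kept. For `X` a point
this is the partial trace over the register. -/
def forget {H : Space k} {X Y : Type} [Fintype Y] (g : Y → X) (ρ : RegOp H Y) : RegOp H X :=
  fun x => ∑ y with g y = x, ρ y

/-- `|ψ⟩⟨ψ|` is transformed into `∑ₓ P(x) |φₓ⟩⟨φₓ| ⊗ |x⟩⟨x|` by an LOCC channel: a composition of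
remembering one-step LOCC channels, followed by forgetting a part of the register. -/
def LOCC {H K : Space k} {X : Type} (ψ : H.Sphere) (P : X → ℝ) (φ : X → K.Sphere) : Prop :=
  ∃ (Y : Type) (_ : Fintype Y) (Λ : RegOp H Unit → RegOp K Y) (g : Y → X),
    IsProtocol H K Unit Y Λ ∧
    forget g (Λ fun _ => proj ψ.1) = fun x => (P x : ℂ) • proj (φ x).1

/-! ### Entanglement measures -/

/-- Real functions on the `k`-partite unit vectors of all finite dimensions. -/
abbrev EntMeasure (k : ℕ) : Type 1 := ∀ H : Space k, H.Sphere → ℝ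

def Subadditive (E : EntMeasure k) : Prop :=
  ∀ (H K : Space k) (ψ : H.Sphere) (φ : K.Sphere),
    E (H.tensor K) (tensor ψ φ) ≤ E H ψ + E K φ

def Additive (E : EntMeasure k) : Prop :=
  ∀ (H K : Space k) (ψ : H.Sphere) (φ : K.Sphere),
    E (H.tensor K) (tensor ψ φ) = E H ψ + E K φ

/-- `E(ψ₁ ⊕ ⋯ ⊕ ψ_l) ≤ maxⱼ E(ψⱼ / ‖ψⱼ‖) + log₂ l` whenever `ψ₁ ⊕ ⋯ ⊕ ψ_l` is a unit vector and
all `ψⱼ` are nonzero. (Then `l ≥ 1`, and the supremum is over a finite nonempty set.) -/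
def LogBounded (E : EntMeasure k) : Prop :=
  ∀ (l : ℕ) (H : Fin l → Space k) (ψ : ∀ j, (H j).Vec) (hψ : ∀ j, ψ j ≠ 0)
    (hunit : ‖directSumVec ψ‖ = 1),
    E (Space.directSum H) ⟨directSumVec ψ, hunit⟩ ≤
      (⨆ j, E (H j) (normalize (ψ j) (hψ j))) + Real.logb 2 l

def MonotoneOnAverage (E : EntMeasure k) : Prop :=
  ∀ (H K : Space k) (X : Type) [Fintype X] (P : X → ℝ) (ψ : H.Sphere) (φ : X → K.Sphere),
    (∀ x, 0 ≤ P x) → ∑ x, P x = 1 → LOCC ψ P φ → ∑ x, P x * E K (φ x) ≤ E H ψ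

def WeaklyMonotone (E : EntMeasure k) : Prop :=
  ∀ (H K : Space k) (X : Type) [Fintype X] (P : X → ℝ) (ψ : H.Sphere) (φ : X → K.Sphere),
    (∀ x, 0 ≤ P x) → ∑ x, P x = 1 → LOCC ψ P φ → ∀ x, P x * E K (φ x) ≤ E H ψ

/-- The class `F_{sub,k}`. -/
structure MemFsub (E : EntMeasure k) : Prop where
  nonneg : ∀ (H : Space k) (ψ : H.Sphere), 0 ≤ E H ψ
  subadditive : Subadditive E
  logBounded : LogBounded E
  monotoneOnAverage : MonotoneOnAverage E

/-- `E^ε(ψ) = inf {E(φ) : φ ∈ 𝕊(H), |⟨φ|ψ⟩|² ≥ 1 - ε}`. -/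
def smoothed (E : EntMeasure k) (ε : ℝ) (H : Space k) (ψ : H.Sphere) : ℝ :=
  ⨅ φ : {φ : H.Sphere // 1 - ε ≤ ‖inner ℂ φ.1 ψ.1‖ ^ 2}, E H φ.1

/-- `limsup_{n → ∞} (1/n) E^ε(ψ^{⊗ n})`. -/
def smoothedRate (E : EntMeasure k) (H : Space k) (ψ : H.Sphere) (ε : ℝ) : ℝ :=
  Filter.limsup (fun n : ℕ => (1 / (n : ℝ)) * smoothed E ε (H.pow n) (tpow ψ n)) Filter.atTop

/-- The smoothing limit `Φ(E)(ψ) = lim_{ε → 0} limsup_{n → ∞} (1/n) E^ε(ψ^{⊗ n})`. -/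
def smoothingLimit (E : EntMeasure k) : EntMeasure k := fun H ψ =>
  Filter.limUnder (nhdsWithin (0 : ℝ) (Set.Ioi 0)) (smoothedRate E H ψ)

/-! ### The smoothing limit is well defined on `F_{sub,k}` -/

/-- The image of `ψ` under a renaming of the local bases. -/
def relabel {H K : Space k} (e : ∀ j, H.ι j ≃ K.ι j) (ψ : H.Sphere) : K.Sphere :=
  ⟨WithLp.toLp 2 fun x => ψ.1 fun j => (e j).symm (x j), by
    have h : ‖(WithLp.toLp 2 fun x => ψ.1 fun j => (e j).symm (x j) : K.Vec)‖ ^ 2 = ‖ψ.1‖ ^ 2 := by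
      rw [EuclideanSpace.norm_sq_eq, EuclideanSpace.norm_sq_eq]
      exact Fintype.sum_equiv (Equiv.piCongrRight fun j => (e j).symm) _ _ fun x => rfl
    exact ((sq_eq_sq₀ (norm_nonneg _) (norm_nonneg _)).mp h).trans ψ.2⟩

open Classical in
theorem LOCC_relabel (hk : 1 ≤ k) {H K : Space k} (e : ∀ j, H.ι j ≃ K.ι j) (ψ : H.Sphere) :
    LOCC ψ (fun _ : Unit => 1) (fun _ => relabel e ψ) := by
  let i : Fin k := ⟨0, hk⟩
  let A : Matrix (K.ι i) (H.ι i) ℂ := Matrix.of fun a b => if a = e i b then 1 else 0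
  have hA : IsKraus (fun _ : Unit => ()) (fun _ => A) := by
    intro x
    have : A.conjTranspose * A = 1 := by
      ext a b
      simp [A, Matrix.mul_apply, Matrix.one_apply, eq_comm]
    simp [this, Matrix.PosSemidef.zero]
  refine ⟨Unit, inferInstance, _, id, .step id (.refl H Unit) i (fun j _ => e j) (fun _ => ()) (fun _ => A) hA, ?_⟩
  have hl : localOp i (fun j _ => e j) A = Matrix.of fun x y =>
      if y = (fun j => (e j).symm (x j)) then (1 : ℂ) else 0 := by
    ext x y
    simp only [localOp, A, Matrix.of_apply, ← ite_and]
    congr 1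
    simp only [funext_iff, Equiv.eq_symm_apply, eq_iff_iff]
    constructor
    · rintro ⟨h1, h2⟩ j
      by_cases h : j = i
      · subst h; exact h2.symm
      · exact (h1 j h).symm
    · intro h
      exact ⟨fun j _ => (h j).symm, (h i).symm⟩
  funext x
  ext a b
  simp [forget, stepMap, hl, proj, relabel, Matrix.mul_apply, Matrix.vecMulVec_apply,
    Matrix.conjTranspose_apply, apply_ite]

theorem MemFsub.relabel_le (hk : 1 ≤ k) {E : EntMeasure k} (hE : MemFsub E) {H K : Space k}
    (e : ∀ j, H.ι j ≃ K.ι j) (ψ : H.Sphere) : E K (relabel e ψ) ≤ E H ψ := by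
  simpa using hE.monotoneOnAverage H K Unit (fun _ => 1) ψ _ (by simp) (by simp)
    (LOCC_relabel hk e ψ)

theorem MemFsub.tpow_succ_le (hk : 1 ≤ k) {E : EntMeasure k} (hE : MemFsub E) {H : Space k}
    (ψ : H.Sphere) (n : ℕ) :
    E (H.pow (n + 1)) (tpow ψ (n + 1)) ≤ E (H.pow n) (tpow ψ n) + E H ψ := by
  have h := hE.relabel_le hk (H := (H.pow n).tensor H) (K := H.pow (n + 1))
    (fun j => Fin.snocEquiv (fun _ => H.ι j) |>.symm.trans (Equiv.prodComm _ _) |>.symm)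
    (tensor (tpow ψ n) ψ)
  refine le_trans (le_of_eq ?_) (h.trans (hE.subadditive _ _ _ _))
  congr 1
  apply Subtype.ext
  ext x
  simp [relabel, tensor, tpow, tensorVec, powVec, Fin.prod_univ_castSucc, Fin.snocEquiv]
  rfl

theorem MemFsub.tpow_le (hk : 1 ≤ k) {E : EntMeasure k} (hE : MemFsub E) {H : Space k}
    (ψ : H.Sphere) (n : ℕ) :
    E (H.pow n) (tpow ψ n) ≤ E (H.pow 0) (tpow ψ 0) + n * E H ψ := by
  induction n with
  | zero => simp
  | succ n ih => push_cast; linarith [hE.tpow_succ_le hk ψ n]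

theorem MemFsub.smoothed_nonneg {E : EntMeasure k} (hE : MemFsub E) (ε : ℝ) {H : Space k}
    (ψ : H.Sphere) : 0 ≤ smoothed E ε H ψ :=
  Real.iInf_nonneg fun _ => hE.nonneg _ _

theorem MemFsub.smoothed_le {E : EntMeasure k} (hE : MemFsub E) {ε : ℝ} (hε : 0 ≤ ε) {H : Space k}
    (ψ : H.Sphere) : smoothed E ε H ψ ≤ E H ψ := by
  refine ciInf_le (f := fun φ : {φ : H.Sphere // 1 - ε ≤ ‖inner ℂ φ.1 ψ.1‖ ^ 2} => E H φ.1)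
    ⟨0, by rintro _ ⟨_, rfl⟩; exact hE.nonneg _ _⟩ ⟨ψ, ?_⟩
  simp [inner_self_eq_norm_sq_to_K, ψ.2, hε]

theorem MemFsub.smoothed_anti {E : EntMeasure k} (hE : MemFsub E) {ε δ : ℝ} (hε : 0 ≤ ε)
    (h : ε ≤ δ) {H : Space k} (ψ : H.Sphere) : smoothed E δ H ψ ≤ smoothed E ε H ψ := by
  have : Nonempty {φ : H.Sphere // 1 - ε ≤ ‖inner ℂ φ.1 ψ.1‖ ^ 2} :=
    ⟨ψ, by simp [inner_self_eq_norm_sq_to_K, ψ.2, hε]⟩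
  refine le_ciInf fun φ => ?_
  exact ciInf_le (f := fun φ : {φ : H.Sphere // 1 - δ ≤ ‖inner ℂ φ.1 ψ.1‖ ^ 2} => E H φ.1)
    ⟨0, by rintro _ ⟨_, rfl⟩; exact hE.nonneg _ _⟩ ⟨φ.1, by linarith [φ.2]⟩

/-- The limit in the definition of `Φ(E)` exists for `E` in `F_{sub,k}`, and the sequences in
the upper limits are bounded. -/
theorem MemFsub.tendsto_smoothedRate (hk : 1 ≤ k) {E : EntMeasure k} (hE : MemFsub E)
    (H : Space k) (ψ : H.Sphere) :
    (∃ C, ∀ ε, 0 ≤ ε → ∀ n : ℕ, (1 / (n : ℝ)) * smoothed E ε (H.pow n) (tpow ψ n) ∈ Set.Icc 0 C) ∧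
    Filter.Tendsto (smoothedRate E H ψ) (nhdsWithin 0 (Set.Ioi 0))
      (nhds (smoothingLimit E H ψ)) := by
  have hb : ∀ ε, 0 ≤ ε → ∀ n : ℕ, (1 / (n : ℝ)) * smoothed E ε (H.pow n) (tpow ψ n) ∈
      Set.Icc 0 (E (H.pow 0) (tpow ψ 0) + E H ψ) := by
    intro ε hε n
    refine ⟨mul_nonneg (by positivity) (hE.smoothed_nonneg _ _), ?_⟩
    have h0 := hE.nonneg _ (tpow ψ 0)
    have h1 := hE.nonneg _ ψ
    rcases Nat.eq_zero_or_pos n with rfl | hn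
    · simpa using add_nonneg h0 h1
    have hn' : (1 : ℝ) ≤ n := by exact_mod_cast hn
    rw [one_div, inv_mul_le_iff₀ (by positivity)]
    have := (hE.smoothed_le hε (tpow ψ n)).trans (hE.tpow_le hk ψ n)
    nlinarith
  have hbdd : ∀ ε, 0 ≤ ε → Filter.IsBoundedUnder (· ≤ ·) Filter.atTop
      (fun n : ℕ => (1 / (n : ℝ)) * smoothed E ε (H.pow n) (tpow ψ n)) := fun ε hε =>
    Filter.isBoundedUnder_of ⟨_, fun n => (hb ε hε n).2⟩
  have hcob : ∀ ε, 0 ≤ ε → Filter.IsCoboundedUnder (· ≤ ·) Filter.atTop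
      (fun n : ℕ => (1 / (n : ℝ)) * smoothed E ε (H.pow n) (tpow ψ n)) := fun ε hε =>
    (Filter.isBoundedUnder_of ⟨_, fun n => (hb ε hε n).1⟩).isCoboundedUnder_le
  have hanti : AntitoneOn (smoothedRate E H ψ) (Set.Ioi 0) := by
    intro ε hε δ hδ h
    have hε' : (0 : ℝ) < ε := hε
    refine Filter.limsup_le_limsup (Filter.Eventually.of_forall fun n => ?_)
      (hcob δ (hε'.le.trans h)) (hbdd ε hε'.le)
    exact mul_le_mul_of_nonneg_left (hE.smoothed_anti hε'.le h _) (by positivity)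
  refine ⟨⟨_, hb⟩, tendsto_nhds_limUnder ⟨_, hanti.tendsto_nhdsGT ?_⟩⟩
  refine ⟨E (H.pow 0) (tpow ψ 0) + E H ψ, ?_⟩
  rintro _ ⟨ε, hε, rfl⟩
  have hε' : (0 : ℝ) < ε := hε
  exact Filter.limsup_le_of_le (hcob ε hε'.le) (Filter.Eventually.of_forall fun n => (hb ε hε'.le n).2)

end Multipartite

end

/-!
Write `Φ` for the smoothing limit of `E`. All three properties are reduced to one description of
it (`MemFsub.smoothingLimit_le_iff`): `Φ(ψ) ≤ c` holds if and only if for all `ε > 0` and `s > c`,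
for all large `n`, some unit vector `χ` with `‖χ - ψ^{⊗ n}‖² ≤ ε` satisfies `E(χ) ≤ n s`. The
infimum in `Φ` only controls the modulus of an overlap, but `E` does not change under a phase, so
overlap and distance are interchangeable.

*Protocols.* A transformation of `ψ` into the ensemble `(P, φ)` is given by Kraus operators `M_y`
with `M_y ψ = c_y φ_{g(y)}` and `∑_{g(y) = x} |c_y|² = P(x)`. As `P` sums up to one, each step of
the protocol can be completed to a trace-preserving one by outcomes that do not occur on `ψ`
(`LOCC.exists_instr`). Trace-preserving protocols (`Instr`) can be composed, applied to one tensor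
factor and applied to many copies, and a tensor factor can be discarded by local measurements.

*One good outcome.* If `χ` is close to `ψ`, then `∑_y ‖M_y χ - M_y ψ‖² = ‖χ - ψ‖²` is small, hence
so is the average, over the outcomes obtained from `χ`, of the squared distance of the outcome
from the line through `φ_{g(y)}`; the average of `E` is at most `E(χ)`. By Markov's inequality
some outcome in a prescribed likely set is close to `φ_{g(y)}` and has a value of `E` at most
`s E(χ)`, for any `s > 1` (`MemFsub.exists_outcome`).

*Weak monotonicity.* Apply the protocol to `n` copies. By Chebyshev's inequality the outcome word
typically contains each `x` at least `n (P(x) - δ)` times. Discarding the superfluous factors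
gives, from an approximation of `ψ^{⊗ n}`, one of any product of the `φ_x` that uses each of them
a bit less often than `n P(x)` times (`MemFsub.exists_approx_word`). With copies of a single `φ_x`
this says `P(x) Φ(φ_x) ≤ Φ(ψ)`.

*Average.* With `a_x` copies of each `φ_x`, where `a_x < N P(x)`, it says
`Φ(⨂ φ_x^{⊗ a_x}) ≤ N Φ(ψ)`. If `Φ` is additive, then `∑_x a_x Φ(φ_x) ≤ N Φ(ψ)`; divide by `N` and let `N → ∞`.

*Logarithmic boundedness.* The vector `(ψ₁ ⊕ ⋯ ⊕ ψ_l)^{⊗ n}` is the direct sum, over the `lⁿ`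
words `w`, of `⨂ₘ ψ_{w(m)}`. Subadditivity of `E` provides approximations of the normalized
summands, uniform in `w`, with values of `E` at most `n s' + C` for any `s' > maxⱼ Φ(ψⱼ / ‖ψⱼ‖)`.
Their direct sum, with the same weights, approximates the tensor power and has `E` at most
`n s' + C + n log l`.
-/

noncomputable section

namespace Multipartite

open scoped ComplexOrder Matrix

variable {k : ℕ}

/-! ### Tensor products of finite families and renaming of bases -/

/-- The tensor product `⨂ⱼ H(j)` of a finite family of `k`-partite spaces, taken party by party. For
a constant family over `Fin n` this is `Space.pow` by definition. -/
def Space.pi {J : Type} [Fintype J] [DecidableEq J] (H : J → Space k) : Space k where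
  ι i := ∀ j, (H j).ι i
  fin _ := inferInstance

section Pi

variable {J : Type} [Fintype J] [DecidableEq J] {H : J → Space k}

/-- The product vector `⨂ⱼ v(j)`. -/
def prodVec (v : ∀ j, (H j).Vec) : (Space.pi H).Vec :=
  WithLp.toLp 2 fun x => ∏ j, v j (fun i => x i j)

theorem inner_prodVec (v w : ∀ j, (H j).Vec) :
    inner ℂ (prodVec v) (prodVec w) = ∏ j, inner ℂ (v j) (w j) := by
  simp only [PiLp.inner_apply, prodVec, RCLike.inner_apply, map_prod, ← Finset.prod_mul_distrib]
  rw [Finset.prod_univ_sum, Fintype.piFinset_univ]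
  exact Fintype.sum_equiv (Equiv.piComm fun (i : Fin k) (j : J) => (H j).ι i) _ _ fun x => rfl

theorem norm_prodVec (v : ∀ j, (H j).Vec) : ‖prodVec v‖ = ∏ j, ‖v j‖ := by
  have h : ((‖prodVec v‖ ^ 2 : ℝ) : ℂ) = ((∏ j, ‖v j‖) ^ 2 : ℝ) := by
    have := inner_prodVec v v
    simp only [inner_self_eq_norm_sq_to_K, Finset.prod_pow] at this
    simpa using this
  exact (sq_eq_sq₀ (norm_nonneg _) (Finset.prod_nonneg fun _ _ => norm_nonneg _)).mp
    (Complex.ofReal_injective h)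

theorem prodVec_smul (a : J → ℂ) (v : ∀ j, (H j).Vec) :
    prodVec (fun j => a j • v j) = (∏ j, a j) • prodVec v := by
  ext x
  simp [prodVec, Finset.prod_mul_distrib]

/-- The product of a finite family of unit vectors. -/
def prod (ψ : ∀ j, (H j).Sphere) : (Space.pi H).Sphere :=
  ⟨prodVec fun j => (ψ j).1, by simp [norm_prodVec, (ψ _).2]⟩

end Pi

/-- The unitary that renames the local bases along `e`. -/
def relabelVec {H K : Space k} (e : ∀ j, H.ι j ≃ K.ι j) : H.Vec ≃ₗᵢ[ℂ] K.Vec :=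
  LinearIsometryEquiv.piLpCongrLeft 2 ℂ ℂ (Equiv.piCongrRight e)

theorem relabelVec_apply {H K : Space k} (e : ∀ j, H.ι j ≃ K.ι j) (v : H.Vec) (x : K.Idx) :
    relabelVec e v x = v fun j => (e j).symm (x j) := rfl

theorem relabel_val {H K : Space k} (e : ∀ j, H.ι j ≃ K.ι j) (ψ : H.Sphere) :
    (relabel e ψ).1 = relabelVec e ψ.1 := rfl

theorem norm_relabel_sub {H K : Space k} (e : ∀ j, H.ι j ≃ K.ι j) (χ ψ : H.Sphere) :
    ‖(relabel e χ).1 - (relabel e ψ).1‖ = ‖χ.1 - ψ.1‖ := by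
  rw [relabel_val, relabel_val, ← map_sub, LinearIsometryEquiv.norm_map]

/-! ### Unit vectors up to a phase -/

/-- The unit vector `c ψ` for a complex number `c` of modulus one. -/
def phase {H : Space k} (c : ℂ) (hc : ‖c‖ = 1) (ψ : H.Sphere) : H.Sphere :=
  ⟨c • ψ.1, by rw [norm_smul, hc, ψ.2, one_mul]⟩

theorem norm_sub_sq_sphere {H : Space k} (χ ψ : H.Sphere) :
    ‖χ.1 - ψ.1‖ ^ 2 = 2 - 2 * (inner ℂ χ.1 ψ.1).re := by
  rw [@norm_sub_sq ℂ, χ.2, ψ.2]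
  simp; ring

theorem norm_inner_sphere_le {H : Space k} (χ ψ : H.Sphere) : ‖inner ℂ χ.1 ψ.1‖ ≤ 1 := by
  simpa [χ.2, ψ.2] using norm_inner_le_norm (𝕜 := ℂ) χ.1 ψ.1

/-- After a change of phase, the distance of two unit vectors is controlled by their overlap. -/
theorem exists_phase {H : Space k} (χ ψ : H.Sphere) :
    ∃ (c : ℂ) (hc : ‖c‖ = 1),
      ‖(phase c hc χ).1 - ψ.1‖ ^ 2 ≤ 2 * (1 - ‖inner ℂ χ.1 ψ.1‖ ^ 2) := by
  set z := inner ℂ χ.1 ψ.1 with hz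
  obtain ⟨c, hc, hcz⟩ : ∃ c : ℂ, ‖c‖ = 1 ∧ (starRingEnd ℂ) c * z = ‖z‖ := by
    by_cases h : z = 0
    · exact ⟨1, by simp, by simp [h]⟩
    · have h' : (‖z‖ : ℂ) ≠ 0 := by exact_mod_cast norm_ne_zero_iff.mpr h
      refine ⟨z / ‖z‖, by simp [h], ?_⟩
      rw [map_div₀, Complex.conj_ofReal, div_mul_eq_mul_div, mul_comm, Complex.mul_conj,
        Complex.normSq_eq_norm_sq]
      field_simp
      push_cast
      ring
  refine ⟨c, hc, ?_⟩
  rw [norm_sub_sq_sphere]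
  have : inner ℂ (phase c hc χ).1 ψ.1 = (‖z‖ : ℂ) := by
    simp only [phase, inner_smul_left]
    exact hcz
  rw [this, Complex.ofReal_re]
  nlinarith [norm_inner_sphere_le χ ψ, norm_nonneg z]

/-- Close unit vectors have a large overlap. -/
theorem one_sub_le_norm_inner {H : Space k} {χ ψ : H.Sphere} {ε : ℝ}
    (h : ‖χ.1 - ψ.1‖ ^ 2 ≤ ε) : 1 - ε / 2 ≤ ‖inner ℂ χ.1 ψ.1‖ := by
  rw [norm_sub_sq_sphere] at h
  linarith [Complex.re_le_norm (inner ℂ χ.1 ψ.1)]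

theorem one_sub_le_norm_inner_sq {H : Space k} {χ ψ : H.Sphere} {ε : ℝ}
    (h : ‖χ.1 - ψ.1‖ ^ 2 ≤ ε) : 1 - ε ≤ ‖inner ℂ χ.1 ψ.1‖ ^ 2 := by
  nlinarith [one_sub_le_norm_inner h, sq_nonneg (‖inner ℂ χ.1 ψ.1‖ - 1)]

/-- `1 - |⟨u, φ⟩|²` is the squared distance of `u` from the line through `φ`, so it bounds the
distance from every point of this line from below; here for a vector `v` that need not be
normalized. -/
theorem norm_sq_mul_one_sub_le {V : Type*} [NormedAddCommGroup V] [InnerProductSpace ℂ V]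
    {u φ : V} (hu : ‖u‖ = 1) (hφ : ‖φ‖ = 1) (r c : ℂ) :
    ‖r‖ ^ 2 * (1 - ‖inner ℂ u φ‖ ^ 2) ≤ ‖r • u - c • φ‖ ^ 2 := by
  rw [@norm_sub_sq ℂ, norm_smul, norm_smul, hu, hφ, inner_smul_left, inner_smul_right]
  have h : (RCLike.re ((starRingEnd ℂ) r * (c * inner ℂ u φ)) : ℝ) ≤
      ‖r‖ * (‖c‖ * ‖inner ℂ u φ‖) := by
    refine (Complex.re_le_norm _).trans (le_of_eq ?_)
    simp
  nlinarith [sq_nonneg (‖r‖ * ‖inner ℂ u φ‖ - ‖c‖)]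

/-! ### Trace-preserving protocols in terms of Kraus operators -/

/-- The action of a matrix on vectors of `k`-partite spaces. -/
def act {H K : Space k} (M : Matrix K.Idx H.Idx ℂ) : H.Vec →ₗ[ℂ] K.Vec := by
  classical exact Matrix.toEuclideanLin M

theorem act_apply {H K : Space k} (M : Matrix K.Idx H.Idx ℂ) (v : H.Vec) (x : K.Idx) :
    act M v x = ∑ y, M x y * v y := rfl

theorem act_mul {H K L : Space k} (N : Matrix L.Idx K.Idx ℂ) (M : Matrix K.Idx H.Idx ℂ)
    (v : H.Vec) : act (N * M) v = act N (act M v) := by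
  apply PiLp.ext
  exact congrFun (Matrix.mulVec_mulVec v.ofLp N M).symm

open Classical in
theorem act_one {H : Space k} (v : H.Vec) : act (1 : Matrix H.Idx H.Idx ℂ) v = v := by
  ext x; simp [act_apply, Matrix.one_apply]

theorem mul_proj_mul {H K : Space k} (M : Matrix K.Idx H.Idx ℂ) (v : H.Vec) :
    M * proj v * M.conjTranspose = proj (act M v) := by
  rw [proj, proj, Matrix.mul_vecMulVec, Matrix.vecMulVec_mul, ← Matrix.star_mulVec]
  rfl

/-- A sum over tuples with all but the `i`-th entry prescribed is a sum over the `i`-th entry. -/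
theorem sum_prescribed {β : Fin k → Type} [∀ j, Fintype (β j)] (i : Fin k) (z : ∀ j, j ≠ i → β j)
    [∀ x : ∀ j, β j, Decidable (∀ j (h : j ≠ i), x j = z j h)] (F : β i → ℂ) :
    (∑ x : ∀ j, β j, if ∀ j (h : j ≠ i), x j = z j h then F (x i) else 0) = ∑ a, F a := by
  classical
  rw [← Equiv.sum_comp (Equiv.piSplitAt i β).symm, Fintype.sum_prod_type]
  refine Finset.sum_congr rfl fun a _ => ?_
  refine (Finset.sum_eq_single (fun j : {j // j ≠ i} => z j.1 j.2) ?_ ?_).trans ?_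
  rotate_right
  · rw [if_pos]
    · simp [Equiv.piSplitAt]
    · intro j h; simp [Equiv.piSplitAt, h]
  · intro u _ hu
    rw [if_neg]
    intro h
    apply hu
    funext j
    simpa [Equiv.piSplitAt, j.2] using h j.1 j.2
  · simp

open Classical in
theorem localOp_apply {H K : Space k} (i : Fin k) (e : ∀ j, j ≠ i → H.ι j ≃ K.ι j)
    (A : Matrix (K.ι i) (H.ι i) ℂ) (x : K.Idx) (y : H.Idx) :
    localOp i e A x y = if ∀ j (h : j ≠ i), x j = e j h (y j) then A (x i) (y i) else 0 := rfl

open Classical in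
theorem localOp_conjTranspose_mul {H K : Space k} (i : Fin k) (e : ∀ j, j ≠ i → H.ι j ≃ K.ι j)
    (A : Matrix (K.ι i) (H.ι i) ℂ) :
    (localOp i e A)ᴴ * localOp i e A = localOp (K := H) i (fun _ _ => Equiv.refl _) (Aᴴ * A) := by
  ext y y'
  rw [Matrix.mul_apply, localOp_apply]
  simp only [localOp_apply, Matrix.conjTranspose_apply, Matrix.mul_apply]
  by_cases h : ∀ j (_ : j ≠ i), y j = y' j
  · refine Eq.trans ?_ (if_pos h).symm
    rw [← sum_prescribed (β := K.ι) i (fun j hj => e j hj (y j))]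
    refine Finset.sum_congr rfl fun x _ => ?_
    by_cases hx : ∀ j (hj : j ≠ i), x j = e j hj (y j)
    · have hx' : ∀ j (hj : j ≠ i), x j = e j hj (y' j) := fun j hj => by rw [hx j hj, h j hj]
      rw [if_pos hx, if_pos hx', if_pos hx]
    · rw [if_neg hx, if_neg hx]; simp
  · refine Eq.trans ?_ (if_neg h).symm
    refine Finset.sum_eq_zero fun x _ => ?_
    by_cases hx : ∀ j (hj : j ≠ i), x j = e j hj (y j)
    · rw [if_neg (c := ∀ j (hj : j ≠ i), x j = e j hj (y' j)), mul_zero]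
      intro hx'
      exact h fun j hj => (e j hj).injective ((hx j hj).symm.trans (hx' j hj))
    · rw [if_neg hx]; simp

open Classical in
theorem localOp_one {H : Space k} (i : Fin k) :
    localOp (H := H) (K := H) i (fun _ _ => Equiv.refl _) 1 = 1 := by
  ext x y
  rw [localOp_apply, Matrix.one_apply, Matrix.one_apply]
  by_cases h : x = y
  · subst h; simp
  · rw [if_neg h]
    split_ifs with h1 h2
    · refine absurd (funext fun j => ?_) h
      by_cases hj : j = i
      · subst hj; exact h2
      · exact h1 j hj
    · rfl
    · rfl

open Classical in
theorem localOp_sum {H K : Space k} {Z : Type} (s : Finset Z) (i : Fin k)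
    (e : ∀ j, j ≠ i → H.ι j ≃ K.ι j) (A : Z → Matrix (K.ι i) (H.ι i) ℂ) :
    ∑ z ∈ s, localOp i e (A z) = localOp i e (∑ z ∈ s, A z) := by
  ext x y
  simp only [Matrix.sum_apply, localOp, Matrix.of_apply]
  split_ifs <;> simp

open Classical in
/-- Trace-preserving protocols that start with a trivial register: `Instr H K Y M` says that the
map `ρ ↦ ∑_y M_y ρ M_y^* ⊗ |y⟩⟨y|` is a composition of remembering one-step channels each of which
preserves the trace. -/
inductive Instr (H : Space k) :
    (K : Space k) → (Y : Type) → (Y → Matrix K.Idx H.Idx ℂ) → Prop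
  | refl : Instr H H Unit (fun _ => 1)
  | step {K L : Space k} {Y Z : Type} [Fintype Z] (M : Y → Matrix K.Idx H.Idx ℂ)
      (hM : Instr H K Y M) (i : Fin k) (e : ∀ j, j ≠ i → K.ι j ≃ L.ι j) (f : Z → Y)
      (A : Z → Matrix (L.ι i) (K.ι i) ℂ)
      (hA : ∀ y, ∑ z with f z = y, (A z)ᴴ * A z = 1) :
      Instr H L Z (fun z => localOp i e (A z) * M (f z))

theorem norm_sq_act {H K : Space k} (M : Matrix K.Idx H.Idx ℂ) (v : H.Vec) :
    ((‖act M v‖ ^ 2 : ℝ) : ℂ) = inner ℂ v (act (Mᴴ * M) v) := by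
  classical
  rw [act_mul, show act Mᴴ = LinearMap.adjoint (act M) from
    Matrix.toEuclideanLin_conjTranspose_eq_adjoint M, LinearMap.adjoint_inner_right,
    inner_self_eq_norm_sq_to_K]
  simp

open Classical in
theorem Instr.finite {H K : Space k} {Y : Type} {M : Y → Matrix K.Idx H.Idx ℂ}
    (h : Instr H K Y M) : Finite Y := by
  cases h <;> infer_instance

open Classical in
theorem Instr.sum_eq_one {H K : Space k} {Y : Type} {M : Y → Matrix K.Idx H.Idx ℂ}
    (h : Instr H K Y M) : ∀ [Fintype Y], ∑ y, (M y)ᴴ * M y = 1 := by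
  induction h with
  | refl => intro; simp
  | @step K L Y Z inst M hM i e f A hA ih =>
    intro inst'
    cases Subsingleton.elim inst inst'
    have := hM.finite
    have := Fintype.ofFinite Y
    rw [← Finset.sum_fiberwise _ f, ← ih]
    refine Finset.sum_congr rfl fun y _ => ?_
    calc _ = ∑ z with f z = y, (M y)ᴴ * ((localOp i e (A z))ᴴ * localOp i e (A z)) * M y := by
          refine Finset.sum_congr rfl fun z hz => ?_
          dsimp only
          rw [(Finset.mem_filter.mp hz).2, Matrix.conjTranspose_mul]
          simp only [Matrix.mul_assoc]
      _ = _ := by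
          rw [← Matrix.sum_mul, ← Matrix.mul_sum]
          simp_rw [localOp_conjTranspose_mul]
          rw [localOp_sum, hA, localOp_one, Matrix.mul_one]

theorem Instr.sum_norm_sq {H K : Space k} {Y : Type} {M : Y → Matrix K.Idx H.Idx ℂ}
    (h : Instr H K Y M) [Fintype Y] (v : H.Vec) : ∑ y, ‖act (M y) v‖ ^ 2 = ‖v‖ ^ 2 := by
  classical
  apply Complex.ofReal_injective
  rw [Complex.ofReal_sum]
  simp_rw [norm_sq_act]
  rw [← inner_sum, ← LinearMap.sum_apply,
    show ∑ y, act ((M y)ᴴ * M y) = act (∑ y, (M y)ᴴ * M y) from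
      (map_sum (Matrix.toEuclideanLin (𝕜 := ℂ)) _ _).symm, h.sum_eq_one, act_one,
      inner_self_eq_norm_sq_to_K]
  simp

theorem Instr.isProtocol {H K : Space k} {Y : Type} {M : Y → Matrix K.Idx H.Idx ℂ}
    (h : Instr H K Y M) :
    IsProtocol H K Unit Y (fun ρ y => M y * ρ () * (M y)ᴴ) := by
  classical
  induction h with
  | refl =>
    convert! IsProtocol.refl H Unit using 1
    funext ρ y
    simp
  | @step K L Y Z _ M hM i e f A hA ih =>
    convert! IsProtocol.step _ ih i e f A ?_ using 1
    · funext ρ z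
      simp [stepMap, Matrix.mul_assoc]
    · intro y
      rw [hA]
      simp [Matrix.PosSemidef.zero]

/-! ### Operations on trace-preserving protocols -/

/-- Renaming the values of the register. -/
theorem Instr.reindex (hk : 1 ≤ k) {H K : Space k} {Y Z : Type} [Fintype Z]
    {M : Y → Matrix K.Idx H.Idx ℂ} (h : Instr H K Y M) (e : Z ≃ Y) :
    Instr H K Z (fun z => M (e z)) := by
  classical
  have := Instr.step M h ⟨0, hk⟩ (fun j _ => Equiv.refl _) e (fun _ => 1) (fun y => by
    have : Finset.univ.filter (fun z => e z = y) = {e.symm y} := by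
      ext z; simp [Equiv.eq_symm_apply]
    rw [this]; simp)
  simpa only [localOp_one, Matrix.one_mul] using this

theorem Instr.comp (hk : 1 ≤ k) {H K L : Space k} {Y Z : Type} [Fintype Y] [Fintype Z]
    {M : Y → Matrix K.Idx H.Idx ℂ} {N : Z → Matrix L.Idx K.Idx ℂ} (hM : Instr H K Y M)
    (hN : Instr K L Z N) : Instr H L (Y × Z) (fun p => N p.2 * M p.1) := by
  classical
  rename_i hY hZ
  clear hZ
  induction hN with
  | refl =>
    simpa using hM.reindex hk (Equiv.prodPUnit Y)
  | @step L L' Z Z' _ N hN i e f A hA ih =>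
    have := Instr.step _ ih i e (fun p : Y × Z' => (p.1, f p.2)) (fun p => A p.2) (fun q => by
      rw [← hA q.2]
      refine Finset.sum_bij' (fun p _ => p.2) (fun z _ => (q.1, z)) ?_ ?_ ?_ ?_ ?_ <;>
        simp +contextual [Prod.ext_iff])
    simpa only [Matrix.mul_assoc] using this

theorem exists_instr_relabel (hk : 1 ≤ k) {H K : Space k} (e : ∀ j, H.ι j ≃ K.ι j) :
    ∃ M, Instr H K Unit M ∧ ∀ v, act (M ()) v = relabelVec e v := by
  classical
  let i : Fin k := ⟨0, hk⟩
  let A : Matrix (K.ι i) (H.ι i) ℂ := Matrix.of fun a b => if a = e i b then 1 else 0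
  have hA : Aᴴ * A = 1 := by
    ext a b
    simp [A, Matrix.mul_apply, Matrix.one_apply, eq_comm]
  refine ⟨_, Instr.step _ Instr.refl i (fun j _ => e j) (fun _ => ()) (fun _ => A)
    (fun y => by simp [hA]), ?_⟩
  intro v
  have hl : localOp i (fun j _ => e j) A = Matrix.of fun x y =>
      if y = (fun j => (e j).symm (x j)) then (1 : ℂ) else 0 := by
    ext x y
    simp only [localOp, A, Matrix.of_apply, ← ite_and]
    congr 1
    simp only [funext_iff, Equiv.eq_symm_apply, eq_iff_iff]
    constructor
    · rintro ⟨h1, h2⟩ j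
      by_cases h : j = i
      · subst h; exact h2.symm
      · exact (h1 j h).symm
    · intro h
      exact ⟨fun j _ => (h j).symm, (h i).symm⟩
  ext x
  simp [act_apply, hl, relabelVec_apply]

open Classical in
/-- The operator `M ⊗ I`. -/
def tensorOne {H K : Space k} (R : Space k) (M : Matrix K.Idx H.Idx ℂ) :
    Matrix (K.tensor R).Idx (H.tensor R).Idx ℂ :=
  Matrix.of fun x y =>
    if (fun i => (x i).2) = (fun i => (y i).2) then M (fun i => (x i).1) (fun i => (y i).1) else 0

open Classical in
theorem tensorOne_apply {H K : Space k} (R : Space k) (M : Matrix K.Idx H.Idx ℂ)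
    (x : (K.tensor R).Idx) (y : (H.tensor R).Idx) : tensorOne R M x y =
      if ∀ i, (x i).2 = (y i).2 then M (fun i => (x i).1) (fun i => (y i).1) else 0 :=
  if_congr funext_iff rfl rfl

theorem sum_tensor_idx {H R : Space k} (F : H.Idx → R.Idx → ℂ) :
    ∑ y : (H.tensor R).Idx, F (fun i => (y i).1) (fun i => (y i).2) = ∑ a, ∑ b, F a b := by
  rw [← Fintype.sum_prod_type']
  exact Fintype.sum_equiv (Equiv.arrowProdEquivProdArrow (Fin k) H.ι R.ι) _ _ fun x => rfl

theorem act_tensorOne {H K R : Space k} (M : Matrix K.Idx H.Idx ℂ) (v : H.Vec) (r : R.Vec) :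
    act (tensorOne R M) (tensorVec v r) = tensorVec (act M v) r := by
  classical
  ext x
  rw [act_apply]
  have := sum_tensor_idx (fun (a : H.Idx) (b : R.Idx) =>
    (if (fun i => (x i).2) = b then M (fun i => (x i).1) a else 0) * (v a * r b))
  refine Eq.trans this ?_
  simp [tensorVec, act_apply, Finset.sum_mul, mul_assoc]

open Classical in
theorem tensorOne_mul {H K L R : Space k} (N : Matrix L.Idx K.Idx ℂ) (M : Matrix K.Idx H.Idx ℂ) :
    tensorOne R (N * M) = tensorOne R N * tensorOne R M := by
  ext x y
  rw [Matrix.mul_apply]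
  have := sum_tensor_idx (fun (a : K.Idx) (b : R.Idx) =>
    (if (fun i => (x i).2) = b then N (fun i => (x i).1) a else 0) *
    (if b = (fun i => (y i).2) then M a (fun i => (y i).1) else 0))
  refine Eq.trans ?_ this.symm
  simp [tensorOne, Matrix.mul_apply]

open Classical in
theorem tensorOne_one {H R : Space k} :
    tensorOne R (1 : Matrix H.Idx H.Idx ℂ) = 1 := by
  ext x y
  simp only [tensorOne, Matrix.of_apply, Matrix.one_apply, ← ite_and]
  congr 1
  simp only [funext_iff, eq_iff_iff]
  exact ⟨fun h i => Prod.ext (h.2 i) (h.1 i), fun h => ⟨fun i => by rw [h i], fun i => by rw [h i]⟩⟩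

open Classical in
theorem tensorOne_localOp {H K R : Space k} (i : Fin k) (e : ∀ j, j ≠ i → H.ι j ≃ K.ι j)
    (A : Matrix (K.ι i) (H.ι i) ℂ) :
    tensorOne R (localOp i e A) = localOp (H := H.tensor R) (K := K.tensor R) i
      (fun j hj => (e j hj).prodCongr (Equiv.refl _)) (Matrix.kronecker A 1) := by
  ext x y
  have hk : Matrix.kronecker A (1 : Matrix (R.ι i) (R.ι i) ℂ) (x i) (y i) =
      A (x i).1 (y i).1 * if (x i).2 = (y i).2 then 1 else 0 := rfl
  refine (tensorOne_apply _ _ _ _).trans (Eq.trans ?_ (localOp_apply _ _ _ _ _).symm)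
  rw [localOp_apply]
  by_cases h1 : ∀ j, (x j).2 = (y j).2
  · rw [if_pos h1]
    refine if_congr ⟨fun h j hj => Prod.ext (h j hj) (h1 j), fun h j hj => ?_⟩ ?_ rfl
    · rw [h j hj]; rfl
    · rw [hk, if_pos (h1 i), mul_one]
  · rw [if_neg h1]
    split_ifs with h2
    · rw [hk, if_neg, mul_zero]
      intro h3
      refine h1 fun j => ?_
      by_cases hj : j = i
      · subst hj; exact h3
      · rw [h2 j hj]; rfl
    · rfl

theorem sum_kronecker_one {a b r Z : Type} [Fintype a] [Fintype b] [Fintype r] [DecidableEq a]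
    [DecidableEq r] {_ : DecidableEq (a × r)} (s : Finset Z) (A : Z → Matrix b a ℂ)
    (h : ∑ z ∈ s, (A z)ᴴ * A z = 1) :
    ∑ z ∈ s, (Matrix.kronecker (A z) (1 : Matrix r r ℂ))ᴴ *
      Matrix.kronecker (A z) (1 : Matrix r r ℂ) = 1 := by
  have h1 : ∀ z, (Matrix.kronecker (A z) (1 : Matrix r r ℂ))ᴴ *
      Matrix.kronecker (A z) (1 : Matrix r r ℂ) =
        Matrix.kronecker ((A z)ᴴ * A z) (1 : Matrix r r ℂ) := by
    intro z
    rw [Matrix.kronecker, Matrix.conjTranspose_kronecker, ← Matrix.mul_kronecker_mul]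
    simp
  simp_rw [h1]
  ext p q
  rcases p with ⟨p1, p2⟩
  rcases q with ⟨q1, q2⟩
  simp only [Matrix.sum_apply, Matrix.kronecker, Matrix.kroneckerMap_apply, ← Finset.sum_mul]
  rw [← Matrix.sum_apply, h]
  simp only [Matrix.one_apply, Prod.mk.injEq, ite_and, mul_ite, mul_one, mul_zero]
  split_ifs <;> rfl

/-- A protocol can be applied to the first factor of `H ⊗ R`. -/
theorem Instr.ancilla {H K : Space k} {Y : Type} {M : Y → Matrix K.Idx H.Idx ℂ}
    (h : Instr H K Y M) (R : Space k) :
    Instr (H.tensor R) (K.tensor R) Y (fun y => tensorOne R (M y)) := by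
  classical
  induction h with
  | refl => simpa only [tensorOne_one] using Instr.refl
  | @step K L Y Z _ M hM i e f A hA ih =>
    have := Instr.step (L := L.tensor R) _ ih i
      (fun j hj => (e j hj).prodCongr (Equiv.refl (R.ι j))) f
      (fun z => Matrix.kronecker (A z) (1 : Matrix (R.ι i) (R.ι i) ℂ)) (fun y => by
        exact sum_kronecker_one (b := L.ι i) (r := R.ι i) _ _ (hA y))
    simpa only [tensorOne_mul, tensorOne_localOp] using this

/-! ### Kraus operators of a protocol that acts on a pure state -/

theorem exists_conjTranspose_mul_self {a : Type} [Fintype a] {B : Matrix a a ℂ}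
    (hB : B.PosSemidef) : ∃ S : Matrix a a ℂ, B = Sᴴ * S := by
  classical
  obtain ⟨X, hX, -, h⟩ :=
    CFC.exists_sqrt_of_isSelfAdjoint_of_quasispectrumRestricts (a := B) hB.isHermitian
      (by
        open scoped MatrixOrder in
        exact QuasispectrumRestricts.nnreal_of_nonneg hB.nonneg)
  refine ⟨X, ?_⟩
  rw [← Matrix.star_eq_conjTranspose, hX.star_eq, h]

open Classical in
/-- Every positive operator `B = S^* S` on `ℂ^a` is a sum `∑ C^* C` with operators `C` into any
given nonzero space: take `|b₀⟩⟨c| S` for the basis vectors `c`. -/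
theorem exists_completion {a b : Type} [Fintype a] [Fintype b] (b₀ : b) {B : Matrix a a ℂ}
    (hB : B.PosSemidef) :
    ∃ C : a → Matrix b a ℂ, ∑ c, (C c)ᴴ * C c = B := by
  obtain ⟨S, rfl⟩ := exists_conjTranspose_mul_self hB
  refine ⟨fun c => Matrix.of fun x y => if x = b₀ then S c y else 0, ?_⟩
  ext x y
  simp [Matrix.sum_apply, Matrix.mul_apply, Matrix.conjTranspose_apply]

/-- If a protocol `Λ` is preceded by a trace-preserving one, the composition extends to a
trace-preserving one by further register values `Z`, unless `Λ` annihilates everything because it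
passes through a zero-dimensional space. The part `W` of the initial register consists of values
added earlier; nothing is done for these. -/
theorem IsProtocol.exists_instr {H K : Space k} {X Y : Type} {Λ : RegOp H X → RegOp K Y}
    (h : IsProtocol H K X Y Λ) {H₀ : Space k} {W : Type} (N : X ⊕ W → Matrix H.Idx H₀.Idx ℂ)
    (hN : Instr H₀ H (X ⊕ W) N) :
    (∀ ρ y, Λ ρ y = 0) ∨ ∃ (Z : Type) (M : Y ⊕ Z → Matrix K.Idx H₀.Idx ℂ),
      Instr H₀ K (Y ⊕ Z) M ∧ ∀ (ρ : Matrix H₀.Idx H₀.Idx ℂ) y,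
        Λ (fun x => N (.inl x) * ρ * (N (.inl x))ᴴ) y =
        M (.inl y) * ρ * (M (.inl y))ᴴ := by
  classical
  induction h with
  | refl => exact .inr ⟨W, N, hN, fun _ _ => rfl⟩
  | @step K L X Y Z _ Λ hΛ i e f A hA ih =>
    rcases ih N hN with h0 | ⟨V, M, hM, hMΛ⟩
    · left
      intro ρ z
      simp [stepMap, h0]
    by_cases hL : IsEmpty (L.ι i)
    · left
      intro ρ z
      ext x
      exact hL.elim (x i)
    right
    obtain ⟨b₀⟩ := not_isEmpty_iff.mp hL
    have := hM.finite
    have := Fintype.ofFinite (Y ⊕ V)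
    have hB : ∀ q : Y ⊕ V, (1 - ∑ z with Sum.inl (f z) = q, (A z)ᴴ * A z).PosSemidef := by
      rintro (y | v)
      · simpa using hA y
      · simpa using Matrix.PosSemidef.one
    choose C hC using fun q => exists_completion b₀ (hB q)
    have := Instr.step (L := L) (Z := Z ⊕ (Y ⊕ V) × K.ι i) M hM i e
      (Sum.elim (fun z => .inl (f z)) Prod.fst) (Sum.elim A fun p => C p.1 p.2) (fun q => by
        rw [← sub_add_cancel 1 (∑ z with Sum.inl (f z) = q, (A z)ᴴ * A z), ← hC, add_comm,
          Finset.sum_filter, Fintype.sum_sum_type, Finset.sum_filter]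
        refine congrArg₂ _ (Finset.sum_congr rfl fun z _ => ?_) ?_
        · by_cases hz : Sum.inl (f z) = q <;> simp [hz]
        simp only [Sum.elim_inr, Fintype.sum_prod_type]
        refine (Finset.sum_eq_single q ?_ ?_).trans ?_
        · intro p _ hp; simp [hp]
        · simp
        · simp)
    refine ⟨_, _, this, fun ρ z => ?_⟩
    change localOp i e (A z) * Λ _ (f z) * (localOp i e (A z))ᴴ =
      localOp i e (A z) * M (.inl (f z)) * ρ * (localOp i e (A z) * M (.inl (f z)))ᴴ
    rw [hMΛ, Matrix.conjTranspose_mul]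
    simp only [Matrix.mul_assoc]

theorem proj_apply {H : Space k} (v : H.Vec) (x y : H.Idx) :
    proj v x y = v x * star (v y) := rfl

theorem trace_proj {H : Space k} (v : H.Vec) : (proj v).trace = ((‖v‖ ^ 2 : ℝ) : ℂ) := by
  rw [EuclideanSpace.norm_sq_eq, Complex.ofReal_sum]
  refine Finset.sum_congr rfl fun x _ => ?_
  rw [Matrix.diag_apply, proj_apply]
  simp [Complex.mul_conj, Complex.normSq_eq_norm_sq]

/-- The value `⟨u, |v⟩⟨v| u⟩` of the quadratic form of a projector. -/
theorem star_dotProduct_proj {H : Space k} (u v : H.Vec) :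
    ∑ x, ∑ y, star (u x) * proj v x y * u y = ((‖inner ℂ u v‖ ^ 2 : ℝ) : ℂ) := by
  have : ((‖inner ℂ u v‖ ^ 2 : ℝ) : ℂ) = inner ℂ u v * inner ℂ v u := by
    rw [← inner_conj_symm v u, Complex.mul_conj, Complex.normSq_eq_norm_sq]
  rw [this]
  simp only [PiLp.inner_apply, RCLike.inner_apply, proj_apply, Finset.sum_mul_sum]
  refine Finset.sum_congr rfl fun x _ => Finset.sum_congr rfl fun y _ => ?_
  simp
  ring

/-- If projectors onto lines sum up to a multiple of the projector of `φ`, they are all supported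
on the line through `φ`. -/
theorem mem_line_of_sum_proj {H : Space k} {Y : Type} (s : Finset Y) (v : Y → H.Vec)
    (φ : H.Sphere) (p : ℂ) (h : ∑ y ∈ s, proj (v y) = p • proj φ.1) (y : Y) (hy : y ∈ s) :
    v y = inner ℂ φ.1 (v y) • φ.1 := by
  set u := v y - inner ℂ φ.1 (v y) • φ.1 with hu
  have hφφ : inner ℂ φ.1 φ.1 = (1 : ℂ) := by
    rw [inner_self_eq_norm_sq_to_K, φ.2]; simp
  have huφ : inner ℂ u φ.1 = (0 : ℂ) := by
    rw [← inner_conj_symm, hu, inner_sub_right, inner_smul_right, hφφ]; simp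
  have h1 : ∑ z ∈ s, ‖inner ℂ u (v z)‖ ^ 2 = 0 := by
    apply Complex.ofReal_injective
    rw [Complex.ofReal_sum]
    simp_rw [← star_dotProduct_proj]
    rw [Finset.sum_comm]
    have h2 : ∀ x z, ∑ y ∈ s, proj (v y) x z = p * proj φ.1 x z := fun x z => by
      rw [← Matrix.sum_apply, h]; rfl
    calc _ = ∑ x, ∑ z, star (u x) * (∑ y ∈ s, proj (v y) x z) * u z := by
          refine Finset.sum_congr rfl fun x _ => ?_
          rw [Finset.sum_comm]
          simp only [Finset.mul_sum, Finset.sum_mul]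
      _ = p * ∑ x, ∑ z, star (u x) * proj φ.1 x z * u z := by
          simp only [Finset.mul_sum, h2]
          refine Finset.sum_congr rfl fun x _ => Finset.sum_congr rfl fun z _ => ?_
          ring
      _ = _ := by rw [star_dotProduct_proj, huφ]; simp
  have h3 : inner ℂ u (v y) = (0 : ℂ) := by
    have := (Finset.sum_eq_zero_iff_of_nonneg (fun z _ => by positivity)).mp h1 y hy
    simpa using this
  have h4 : inner ℂ u u = (0 : ℂ) := by
    conv_lhs => rw [hu, ← hu, inner_sub_right, inner_smul_right, huφ, h3]
    simp
  exact sub_eq_zero.mp (inner_self_eq_zero.mp h4)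

open Classical in
/-- A transformation of a pure state into an ensemble of pure states comes from a trace-preserving
protocol each of whose outcomes is a multiple of one of the target vectors. -/
theorem LOCC.exists_instr (hk : 1 ≤ k) {H K : Space k} {X : Type} [Fintype X] {ψ : H.Sphere}
    {P : X → ℝ} {φ : X → K.Sphere} (hP : ∑ x, P x = 1) (h : LOCC ψ P φ) :
    ∃ (Y : Type) (_ : Fintype Y) (M : Y → Matrix K.Idx H.Idx ℂ) (g : Y → X) (c : Y → ℂ),
      Instr H K Y M ∧ (∀ y, act (M y) ψ.1 = c y • (φ (g y)).1) ∧
      ∀ x, ∑ y with g y = x, ‖c y‖ ^ 2 = P x := by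
  obtain ⟨Y, _, Λ, g, hΛ, hg⟩ := h
  obtain ⟨x₀⟩ : Nonempty X := by
    by_contra hX
    rw [not_nonempty_iff] at hX
    simp at hP
  have h1 : Instr H H (Unit ⊕ Empty) fun _ => 1 :=
    Instr.refl.reindex hk (Equiv.sumEmpty Unit Empty)
  have hpr : ∀ x, proj (φ x).1 ≠ 0 := fun x h0 => by
    have := trace_proj (φ x).1
    rw [h0, (φ x).2] at this
    simp at this
  rcases hΛ.exists_instr _ h1 with h0 | ⟨Z, M, hM, hMΛ⟩
  · exfalso
    have : ∀ x, P x = 0 := fun x => by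
      have := congrFun hg x
      simp only [forget, h0, Finset.sum_const_zero] at this
      simpa [hpr] using this.symm
    simp [this] at hP
  have hfin := hM.finite
  have hZ : Finite Z := Finite.of_injective (Sum.inr : Z → Y ⊕ Z) Sum.inr_injective
  have := Fintype.ofFinite Z
  have hsum : ∀ x, ∑ y with g y = x, proj (act (M (.inl y)) ψ.1) = (P x : ℂ) • proj (φ x).1 := by
    intro x
    rw [← congrFun hg x]
    simp only [forget]
    refine Finset.sum_congr rfl fun y _ => ?_
    rw [← mul_proj_mul, ← hMΛ]
    simp
  have hnorm : ∀ x, ∑ y with g y = x, ‖act (M (.inl y)) ψ.1‖ ^ 2 = P x := by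
    intro x
    apply Complex.ofReal_injective
    rw [Complex.ofReal_sum]
    simp_rw [← trace_proj]
    rw [← Matrix.trace_sum, hsum, Matrix.trace_smul, trace_proj, (φ x).2]
    simp
  have hzero : ∀ z, act (M (.inr z)) ψ.1 = 0 := by
    have h2 := hM.sum_norm_sq ψ.1
    rw [Fintype.sum_sum_type, ← Finset.sum_fiberwise _ g] at h2
    simp_rw [hnorm] at h2
    rw [hP, ψ.2] at h2
    have h3 : ∑ z, ‖act (M (.inr z)) ψ.1‖ ^ 2 = 0 := by linarith
    intro z
    have := (Finset.sum_eq_zero_iff_of_nonneg (fun z _ => by positivity)).mp h3 z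
      (Finset.mem_univ _)
    simpa using this
  have hline : ∀ y, act (M (.inl y)) ψ.1 =
      inner ℂ (φ (g y)).1 (act (M (.inl y)) ψ.1) • (φ (g y)).1 := fun y =>
    mem_line_of_sum_proj _ (fun y => act (M (.inl y)) ψ.1) _ _ (hsum (g y)) y (by simp)
  refine ⟨Y ⊕ Z, inferInstance, M, Sum.elim g fun _ => x₀,
    Sum.elim (fun y => inner ℂ (φ (g y)).1 (act (M (.inl y)) ψ.1)) fun _ => 0, hM, ?_, ?_⟩
  · rintro (y | z)
    · exact hline y
    · simp [hzero]
  · intro x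
    rw [← hnorm x, Finset.sum_filter, Fintype.sum_sum_type, Finset.sum_filter]
    have : ∀ y, ‖act (M (.inl y)) ψ.1‖ = ‖inner ℂ (φ (g y)).1 (act (M (.inl y)) ψ.1)‖ := fun y => by
      conv_lhs => rw [hline y, norm_smul, (φ (g y)).2, mul_one]
    simp only [Sum.elim_inl, Sum.elim_inr, norm_zero, this]
    simp only [ite_self, Finset.sum_const_zero, add_zero, ne_eq, OfNat.ofNat_ne_zero,
      not_false_eq_true, zero_pow]
    congr!

/-! ### Product protocols and discarding -/

/-- Two protocols can be applied to the two factors of a tensor product. -/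
theorem exists_instr_tensor (hk : 1 ≤ k) {H K H' K' : Space k} {Y Y' : Type} [Fintype Y]
    [Fintype Y'] {M : Y → Matrix K.Idx H.Idx ℂ} {M' : Y' → Matrix K'.Idx H'.Idx ℂ}
    (hM : Instr H K Y M) (hM' : Instr H' K' Y' M') :
    ∃ N, Instr (H.tensor H') (K.tensor K') (Y × Y') N ∧ ∀ y v w,
      act (N y) (tensorVec v w) = tensorVec (act (M y.1) v) (act (M' y.2) w) := by
  have hswap : ∀ {A B : Space k} (v : A.Vec) (w : B.Vec),
      relabelVec (H := A.tensor B) (K := B.tensor A) (fun _ => Equiv.prodComm _ _) (tensorVec v w) =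
        tensorVec w v := by
    intro A B v w
    ext x
    exact mul_comm _ _
  obtain ⟨S, hS, hS'⟩ := exists_instr_relabel hk (H := K.tensor H') (K := H'.tensor K)
    (fun _ => Equiv.prodComm _ _)
  obtain ⟨T, hT, hT'⟩ := exists_instr_relabel hk (H := K'.tensor K) (K := K.tensor K')
    (fun _ => Equiv.prodComm _ _)
  have h := (((hM.ancilla H').comp hk hS).comp hk (hM'.ancilla K)).comp hk hT
  refine ⟨_, h.reindex hk (Z := Y × Y') ⟨fun p => (((p.1, ()), p.2), ()),
    fun q => (q.1.1.1, q.1.2), fun _ => rfl, fun _ => rfl⟩, fun y v w => ?_⟩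
  simp only [Equiv.coe_fn_mk, act_mul, act_tensorOne]
  rw [hS', hswap, act_tensorOne, hT', hswap]

/-- The product of `n` vectors of the same space: `prodVec` for a constant family, with the type
spelled in terms of `Space.pow`. -/
def powProd {H : Space k} {n : ℕ} (v : Fin n → H.Vec) : (H.pow n).Vec := prodVec v

theorem powProd_zero_apply {H : Space k} (v : Fin 0 → H.Vec) (x : (H.pow 0).Idx) :
    powProd v x = 1 := by
  change (∏ m : Fin 0, v m fun i => x i m) = 1
  simp

theorem powProd_succ {K : Space k} {n : ℕ} (v : Fin (n + 1) → K.Vec) :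
    relabelVec (H := K.tensor (K.pow n)) (K := K.pow (n + 1))
      (fun i => Fin.consEquiv fun _ => K.ι i)
      (tensorVec (v 0) (powProd fun m => v m.succ)) =
      powProd v := by
  ext x
  exact (Fin.prod_univ_succ fun m => v m fun i => x i m).symm

/-- The `n`-fold product of a protocol applied to a product vector. -/
theorem exists_instr_pow (hk : 1 ≤ k) {H K : Space k} {Y : Type} [Fintype Y]
    {M : Y → Matrix K.Idx H.Idx ℂ} (hM : Instr H K Y M) (n : ℕ) :
    ∃ N : (Fin n → Y) → Matrix (K.pow n).Idx (H.pow n).Idx ℂ,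
      Instr (H.pow n) (K.pow n) (Fin n → Y) N ∧ ∀ (w : Fin n → Y) (v : Fin n → H.Vec),
        act (N w) (powProd v) =
          powProd fun m => act (M (w m)) (v m) := by
  induction n with
  | zero =>
    obtain ⟨S, hS, hS'⟩ := exists_instr_relabel hk (H := H.pow 0) (K := K.pow 0)
      (fun i => (Equiv.ofUnique (Fin 0 → H.ι i) (Fin 0 → K.ι i)))
    refine ⟨_, hS.reindex hk (Equiv.ofUnique (Fin 0 → Y) Unit), fun w v => ?_⟩
    refine (hS' _).trans ?_
    ext x
    exact (relabelVec_apply _ _ _).trans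
      ((powProd_zero_apply v _).trans (powProd_zero_apply _ x).symm)
  | succ n ih =>
    obtain ⟨N, hN, hN'⟩ := ih
    obtain ⟨T, hT, hT'⟩ := exists_instr_tensor hk hM hN
    obtain ⟨S, hS, hS'⟩ := exists_instr_relabel hk (H := H.pow (n + 1)) (K := H.tensor (H.pow n))
      (fun i => (Fin.consEquiv fun _ => H.ι i).symm)
    obtain ⟨S₂, hS₂, hS₂'⟩ := exists_instr_relabel hk (H := K.tensor (K.pow n)) (K := K.pow (n + 1))
      (fun i => (Fin.consEquiv fun _ => K.ι i))
    have h := (hS.comp hk hT).comp hk hS₂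
    refine ⟨_, h.reindex hk (Z := Fin (n + 1) → Y) ⟨fun w => (((), w 0, fun m => w m.succ), ()),
      fun q => Fin.cons q.1.2.1 q.1.2.2, fun w => Fin.cons_self_tail w, fun q => rfl⟩,
      fun w v => ?_⟩
    have h1 : relabelVec (H := H.pow (n + 1)) (K := H.tensor (H.pow n))
        (fun i => (Fin.consEquiv fun _ => H.ι i).symm) (powProd v) =
        tensorVec (v 0) (powProd fun m => v m.succ) := by
      rw [← powProd_succ]
      ext x
      rfl
    change act (S₂ () * (T (w 0, fun m => w m.succ) * S ())) _ = _
    rw [act_mul, act_mul, hS', h1, hT', hN', hS₂', ← powProd_succ]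

/-- `R` with the local spaces of the parties in `s` replaced by the line through the basis vector
`r₀`. -/
def Space.collapse (R : Space k) (r₀ : R.Idx) (s : Finset (Fin k)) : Space k where
  ι j := {a : R.ι j // j ∈ s → a = r₀ j}
  fin _ := by classical exact inferInstance

open Classical in
/-- The parties in `s` measure their share of `R` in the local bases. -/
theorem exists_instr_collapse (hk : 1 ≤ k) (R : Space k) (r₀ : R.Idx) (s : Finset (Fin k)) :
    ∃ (Y : Type) (_ : Fintype Y) (M : Y → Matrix (R.collapse r₀ s).Idx R.Idx ℂ),
      Instr R (R.collapse r₀ s) Y M := by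
  induction s using Finset.induction_on with
  | empty =>
    obtain ⟨M, hM, -⟩ := exists_instr_relabel hk (H := R) (K := R.collapse r₀ ∅)
      (fun j => (Equiv.subtypeUnivEquiv (fun a h => by simp at h)).symm)
    exact ⟨Unit, inferInstance, M, hM⟩
  | insert i s hi ih =>
    obtain ⟨Y, _, M, hM⟩ := ih
    let e : ∀ j, j ≠ i → (R.collapse r₀ s).ι j ≃ (R.collapse r₀ (insert i s)).ι j := fun j hj =>
      Equiv.subtypeEquivRight fun a => by simp [hj]
    refine ⟨Y × (R.collapse r₀ s).ι i, inferInstance, _, Instr.step _ hM i e Prod.fst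
      (fun p => Matrix.of fun _ y => if y = p.2 then 1 else 0) fun y => ?_⟩
    have huniq : Unique ((R.collapse r₀ (insert i s)).ι i) :=
      ⟨⟨⟨r₀ i, fun _ => rfl⟩⟩, fun a => Subtype.ext (a.2 (by simp))⟩
    ext a b
    rw [Finset.sum_filter, Fintype.sum_prod_type, Finset.sum_eq_single y]
    · simp [Matrix.sum_apply, Matrix.mul_apply, Matrix.one_apply, eq_comm]
    · intro z _ hz; simp [hz]
    · simp

/-- Discarding the factor `R`: once all parties have measured it, what remains of it is
one-dimensional. -/
theorem exists_instr_discard (hk : 1 ≤ k) (H R : Space k) (r₀ : R.Idx) :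
    ∃ (Y : Type) (_ : Fintype Y) (M : Y → Matrix H.Idx (H.tensor R).Idx ℂ),
      Instr (H.tensor R) H Y M ∧
      ∀ y (v : H.Vec) (r : R.Vec), ∃ c : ℂ, act (M y) (tensorVec v r) = c • v := by
  classical
  obtain ⟨Y, _, N, hN⟩ := exists_instr_collapse hk R r₀ Finset.univ
  have huniq : ∀ j, Unique ((R.collapse r₀ Finset.univ).ι j) := fun j =>
    ⟨⟨⟨r₀ j, fun _ => rfl⟩⟩, fun a => Subtype.ext (a.2 (by simp))⟩
  obtain ⟨T, hT, hT'⟩ := exists_instr_tensor hk (Instr.refl (H := H)) hN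
  obtain ⟨S, hS, hS'⟩ := exists_instr_relabel hk (H := H.tensor (R.collapse r₀ Finset.univ))
    (K := H) (fun j => Equiv.prodUnique _ _)
  refine ⟨_, inferInstance, _, hT.comp hk hS, fun y v r => ?_⟩
  refine ⟨act (N y.1.2) r fun j => ⟨r₀ j, fun _ => rfl⟩, ?_⟩
  dsimp only
  rw [act_mul, hT', hS', act_one]
  ext x
  refine (mul_comm _ _).trans (congrArg₂ _ (congrArg _ ?_) rfl)
  funext j
  exact ((huniq j).uniq _).trans ((huniq j).uniq _).symm

/-! ### Monotonicity under trace-preserving protocols -/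

theorem proj_smul {H : Space k} (c : ℂ) (v : H.Vec) :
    proj (c • v) = ((‖c‖ ^ 2 : ℝ) : ℂ) • proj v := by
  ext x y
  have : ((‖c‖ ^ 2 : ℝ) : ℂ) = c * star c := by
    rw [← Complex.normSq_eq_norm_sq, ← Complex.mul_conj]; rfl
  rw [Matrix.smul_apply, proj_apply, proj_apply, this]
  simp
  ring

theorem MemFsub.phase_le {E : EntMeasure k} (hE : MemFsub E) {H : Space k} (c : ℂ) (hc : ‖c‖ = 1)
    (ψ : H.Sphere) : E H (phase c hc ψ) ≤ E H ψ := by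
  have h : LOCC ψ (fun _ : Unit => 1) fun _ => phase c hc ψ := by
    refine ⟨Unit, inferInstance, id, id, .refl H Unit, ?_⟩
    funext x
    simp [forget, phase, proj_smul, hc]
  simpa using hE.monotoneOnAverage H H Unit (fun _ => 1) ψ _ (by simp) (by simp) h

theorem MemFsub.sum_outcomes_le {E : EntMeasure k} (hE : MemFsub E) {H K : Space k} {Y : Type}
    [Fintype Y] {M : Y → Matrix K.Idx H.Idx ℂ} (hM : Instr H K Y M) (χ : H.Sphere)
    (r : Y → ℂ) (φ : Y → K.Sphere) (h : ∀ y, act (M y) χ.1 = r y • (φ y).1) :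
    ∑ y, ‖r y‖ ^ 2 * E K (φ y) ≤ E H χ := by
  classical
  refine hE.monotoneOnAverage H K Y (fun y => ‖r y‖ ^ 2) χ φ (fun y => by positivity) ?_
    ⟨Y, inferInstance, _, id, hM.isProtocol, ?_⟩
  · have := hM.sum_norm_sq χ.1
    simp_rw [h, norm_smul, (φ _).2, χ.2] at this
    simpa using this
  · funext y
    simp only [forget, id, mul_proj_mul, h, proj_smul]
    rw [Finset.sum_filter]
    simp

theorem norm_smul_normalize {H : Space k} (v : H.Vec) (hv : v ≠ 0) :
    (‖v‖ : ℂ) • (normalize v hv).1 = v := by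
  have : (‖v‖ : ℂ) ≠ 0 := by exact_mod_cast norm_ne_zero_iff.mpr hv
  simp [normalize, smul_smul, this]

theorem Instr.exists_normalized {H K : Space k} {Y : Type} [Fintype Y]
    {M : Y → Matrix K.Idx H.Idx ℂ} (hM : Instr H K Y M) (χ : H.Sphere) :
    ∃ (r : Y → ℂ) (φ : Y → K.Sphere), ∀ y, act (M y) χ.1 = r y • (φ y).1 := by
  obtain ⟨y₀, hy₀⟩ : ∃ y, act (M y) χ.1 ≠ 0 := by
    by_contra! h
    have := hM.sum_norm_sq χ.1
    simp [h, χ.2] at this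
  have : ∀ y, ∃ (r : ℂ) (φ : K.Sphere), act (M y) χ.1 = r • φ.1 := fun y => by
    by_cases hy : act (M y) χ.1 = 0
    · exact ⟨0, normalize _ hy₀, by simp [hy]⟩
    · exact ⟨_, normalize _ hy, (norm_smul_normalize _ hy).symm⟩
  choose r φ h using this
  exact ⟨r, φ, h⟩

/-- If `ψ` is transformed into unit vectors `φ_y`, with an outcome in `B` being unlikely, and `χ` is
close to `ψ`, then the same protocol transforms `χ`, for some outcome `y ∉ B`, into a vector that
is close to `φ_y` and whose value of `E` is hardly larger than that of `χ`. Indeed, the averages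
over the outcomes of `χ` of `E`, of the squared distance from the line through `φ_y`, and of the
indicator of `B` are all controlled. -/
theorem MemFsub.exists_outcome {E : EntMeasure k} (hE : MemFsub E) {s ε' : ℝ} (hs : 1 < s)
    (hε' : 0 < ε') : ∃ κ > 0, ∀ {H K : Space k} {Y : Type} [Fintype Y]
      {M : Y → Matrix K.Idx H.Idx ℂ} (_ : Instr H K Y M) (ψ χ : H.Sphere) (c : Y → ℂ)
      (φ : Y → K.Sphere) (_ : ∀ y, act (M y) ψ.1 = c y • (φ y).1) (B : Finset Y)
      (_ : ∑ y ∈ B, ‖c y‖ ^ 2 ≤ κ) (_ : ‖χ.1 - ψ.1‖ ^ 2 ≤ κ) (T : ℝ) (_ : 0 < T) (_ : E H χ ≤ T),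
      ∃ y ∉ B, ∃ χ' : K.Sphere, ‖χ'.1 - (φ y).1‖ ^ 2 ≤ ε' ∧ E K χ' ≤ s * T := by
  classical
  set ε := min ε' 1 with hε
  have hε0 : 0 < ε := lt_min hε' one_pos
  have hs0 : 0 < s := by linarith
  refine ⟨ε * ((1 - s⁻¹) / 20), ?_, ?_⟩
  · have : s⁻¹ < 1 := inv_lt_one_of_one_lt₀ hs
    have : 0 < 1 - s⁻¹ := by linarith
    positivity
  intro H K Y _ M hM ψ χ c φ hψ B hB hχ T hT hET
  set κ := ε * ((1 - s⁻¹) / 20) with hκ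
  obtain ⟨r, u, hu⟩ := hM.exists_normalized χ
  have hr : ∑ y, ‖r y‖ ^ 2 = 1 := by
    have := hM.sum_norm_sq χ.1
    simp_rw [hu, norm_smul, (u _).2, χ.2] at this
    simpa using this
  have hd : ∑ y, ‖r y • (u y).1 - c y • (φ y).1‖ ^ 2 ≤ κ := by
    have := hM.sum_norm_sq (χ.1 - ψ.1)
    simp_rw [map_sub, hu, hψ] at this
    linarith
  have hF : ∑ y, ‖r y‖ ^ 2 * (1 - ‖inner ℂ (u y).1 (φ y).1‖ ^ 2) ≤ κ :=
    (Finset.sum_le_sum fun y _ =>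
      norm_sq_mul_one_sub_le (u y).2 (φ y).2 (r y) (c y)).trans hd
  -- The outcomes in `B` are unlikely for `χ` as well.
  have hBr : ∑ y, ‖r y‖ ^ 2 * (if y ∈ B then 1 else 0) ≤ 4 * κ := by
    have h1 : ∀ y, ‖r y‖ ^ 2 ≤ 2 * ‖c y‖ ^ 2 + 2 * ‖r y • (u y).1 - c y • (φ y).1‖ ^ 2 := by
      intro y
      have h2 : ‖r y‖ ≤ ‖r y • (u y).1 - c y • (φ y).1‖ + ‖c y‖ := by
        have := norm_add_le (r y • (u y).1 - c y • (φ y).1) (c y • (φ y).1)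
        rwa [sub_add_cancel, norm_smul, norm_smul, (u y).2, (φ y).2, mul_one, mul_one] at this
      nlinarith [sq_nonneg (‖r y • (u y).1 - c y • (φ y).1‖ - ‖c y‖), norm_nonneg (r y)]
    have h3 : ∑ y ∈ B, ‖r y • (u y).1 - c y • (φ y).1‖ ^ 2 ≤ κ :=
      (Finset.sum_le_sum_of_subset_of_nonneg (Finset.subset_univ B)
        fun _ _ _ => by positivity).trans hd
    calc _ = ∑ y ∈ B, ‖r y‖ ^ 2 := by simp [Finset.sum_ite_mem]
      _ ≤ ∑ y ∈ B, (2 * ‖c y‖ ^ 2 + 2 * ‖r y • (u y).1 - c y • (φ y).1‖ ^ 2) :=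
          Finset.sum_le_sum fun y _ => h1 y
      _ ≤ _ := by rw [Finset.sum_add_distrib, ← Finset.mul_sum, ← Finset.mul_sum]; linarith
  have hEavg := hE.sum_outcomes_le hM χ r u hu
  -- Otherwise the sum of the two quotients would be at least one for every outcome, but its average
  -- is at most `s⁻¹ + (1 - s⁻¹) / 2`.
  have key : ∃ y, E K (u y) ≤ s * T ∧
      (1 - ‖inner ℂ (u y).1 (φ y).1‖ ^ 2) + (if y ∈ B then 1 else 0) ≤ ε / 2 := by
    by_contra! hcon
    have h1 : ∀ y, 1 ≤ E K (u y) / (s * T) +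
        ((1 - ‖inner ℂ (u y).1 (φ y).1‖ ^ 2) + (if y ∈ B then 1 else 0)) / (ε / 2) := by
      intro y
      have hn := hE.nonneg K (u y)
      have hn' : 0 ≤ (1 - ‖inner ℂ (u y).1 (φ y).1‖ ^ 2) + (if y ∈ B then (1 : ℝ) else 0) := by
        have := norm_inner_sphere_le (u y) (φ y)
        have h2 : ‖inner ℂ (u y).1 (φ y).1‖ ^ 2 ≤ 1 := by
          nlinarith [norm_nonneg (inner ℂ (u y).1 (φ y).1)]
        split_ifs <;> linarith
      by_cases hy : E K (u y) ≤ s * T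
      · have := (one_lt_div (by positivity : 0 < ε / 2)).mpr (hcon y hy)
        have : 0 ≤ E K (u y) / (s * T) := by positivity
        linarith
      · have := (one_lt_div (by positivity : 0 < s * T)).mpr (not_le.mp hy)
        have : 0 ≤ ((1 - ‖inner ℂ (u y).1 (φ y).1‖ ^ 2) + (if y ∈ B then (1 : ℝ) else 0)) /
            (ε / 2) := by
          positivity
        linarith
    have h2 : (1 : ℝ) ≤ (∑ y, ‖r y‖ ^ 2 * E K (u y)) / (s * T) +
        (∑ y, ‖r y‖ ^ 2 * (1 - ‖inner ℂ (u y).1 (φ y).1‖ ^ 2) +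
          ∑ y, ‖r y‖ ^ 2 * (if y ∈ B then 1 else 0)) / (ε / 2) := by
      rw [← Finset.sum_add_distrib, Finset.sum_div, Finset.sum_div, ← Finset.sum_add_distrib]
      calc (1 : ℝ) = ∑ y, ‖r y‖ ^ 2 * 1 := by simp [hr]
        _ ≤ ∑ y, ‖r y‖ ^ 2 * _ :=
            Finset.sum_le_sum fun y _ => mul_le_mul_of_nonneg_left (h1 y) (by positivity)
        _ = _ := Finset.sum_congr rfl fun y _ => by ring
    have h3 : (∑ y, ‖r y‖ ^ 2 * E K (u y)) / (s * T) ≤ s⁻¹ := by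
      rw [div_le_iff₀ (by positivity), ← mul_assoc, inv_mul_cancel₀ hs0.ne', one_mul]
      exact hEavg.trans hET
    have h4 : (∑ y, ‖r y‖ ^ 2 * (1 - ‖inner ℂ (u y).1 (φ y).1‖ ^ 2) +
          ∑ y, ‖r y‖ ^ 2 * (if y ∈ B then 1 else 0)) / (ε / 2) ≤ (1 - s⁻¹) / 2 := by
      rw [div_le_iff₀ (by positivity)]
      calc _ ≤ κ + 4 * κ := add_le_add hF hBr
        _ = _ := by rw [hκ]; ring
    have h5 : s⁻¹ < 1 := inv_lt_one_of_one_lt₀ hs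
    linarith
  obtain ⟨y, hy1, hy2⟩ := key
  have hle : 0 ≤ 1 - ‖inner ℂ (u y).1 (φ y).1‖ ^ 2 := by
    nlinarith [norm_nonneg (inner ℂ (u y).1 (φ y).1), norm_inner_sphere_le (u y) (φ y)]
  -- The indicator of `B` is below `ε / 2 < 1`, so it vanishes.
  have hyB : y ∉ B := fun hy => by
    rw [if_pos hy] at hy2
    linarith [min_le_right ε' 1]
  rw [if_neg hyB] at hy2
  obtain ⟨z, hz, hz'⟩ := exists_phase (u y) (φ y)
  refine ⟨y, hyB, phase z hz (u y), ?_, (hE.phase_le z hz _).trans hy1⟩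
  linarith [min_le_left ε' 1]

/-- A tensor factor can be discarded at almost no cost. -/
theorem MemFsub.exists_discard (hk : 1 ≤ k) {E : EntMeasure k} (hE : MemFsub E) {s ε' : ℝ}
    (hs : 1 < s) (hε' : 0 < ε') : ∃ κ > 0, ∀ {H R : Space k} (ψ : H.Sphere) (r : R.Sphere)
      (χ : (H.tensor R).Sphere) (_ : ‖χ.1 - (tensor ψ r).1‖ ^ 2 ≤ κ) (T : ℝ) (_ : 0 < T)
      (_ : E _ χ ≤ T), ∃ χ' : H.Sphere, ‖χ'.1 - ψ.1‖ ^ 2 ≤ ε' ∧ E H χ' ≤ s * T := by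
  obtain ⟨κ, hκ, h⟩ := hE.exists_outcome hs hε'
  refine ⟨κ, hκ, fun {H R} ψ r χ hχ T hT hET => ?_⟩
  obtain ⟨r₀⟩ : Nonempty R.Idx := by
    by_contra hR
    rw [not_nonempty_iff] at hR
    have := r.2
    rw [EuclideanSpace.norm_eq] at this
    simp at this
  obtain ⟨Y, _, M, hM, hc⟩ := exists_instr_discard hk H R r₀
  choose c hc using fun y => hc y ψ.1 r.1
  obtain ⟨y, -, χ', h1, h2⟩ := h hM (tensor ψ r) χ c (fun _ => ψ) hc ∅ (by simpa using hκ.le) hχ T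
    hT hET
  exact ⟨χ', h1, h2⟩

/-! ### A description of the smoothing limit -/

theorem MemFsub.smoothedRate_le_smoothingLimit (hk : 1 ≤ k) {E : EntMeasure k} (hE : MemFsub E)
    (H : Space k) (ψ : H.Sphere) {ε : ℝ} (hε : 0 < ε) :
    smoothedRate E H ψ ε ≤ smoothingLimit E H ψ := by
  obtain ⟨⟨C, hC⟩, hlim⟩ := hE.tendsto_smoothedRate hk H ψ
  refine ge_of_tendsto hlim ?_
  filter_upwards [Ioc_mem_nhdsGT hε] with δ hδ
  refine Filter.limsup_le_limsup (Filter.Eventually.of_forall fun n => ?_) ?_ ?_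
  · exact mul_le_mul_of_nonneg_left (hE.smoothed_anti hδ.1.le hδ.2 _) (by positivity)
  · exact (Filter.isBoundedUnder_of ⟨_, fun n => (hC ε hε.le n).1⟩).isCoboundedUnder_le
  · exact Filter.isBoundedUnder_of ⟨_, fun n => (hC δ hδ.1.le n).2⟩

/-- `Φ(E)(ψ) ≤ c` means that arbitrarily good approximations of `ψ^{⊗ n}` have a value of `E` that
is asymptotically at most `c n`. -/
theorem MemFsub.smoothingLimit_le_iff (hk : 1 ≤ k) {E : EntMeasure k} (hE : MemFsub E)
    (H : Space k) (ψ : H.Sphere) (c : ℝ) :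
    smoothingLimit E H ψ ≤ c ↔ ∀ ε > 0, ∀ s > c, ∀ᶠ n : ℕ in Filter.atTop,
      ∃ χ : (H.pow n).Sphere, ‖χ.1 - (tpow ψ n).1‖ ^ 2 ≤ ε ∧ E _ χ ≤ n * s := by
  obtain ⟨⟨C, hC⟩, hlim⟩ := hE.tendsto_smoothedRate hk H ψ
  constructor
  · intro h ε hε s hs
    have hε2 : 0 < ε / 2 := by positivity
    have h1 := ((hE.smoothedRate_le_smoothingLimit hk H ψ hε2).trans h).trans_lt hs
    have h2 := Filter.eventually_lt_of_limsup_lt h1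
      (Filter.isBoundedUnder_of ⟨_, fun n => (hC _ hε2.le n).2⟩)
    filter_upwards [h2, Filter.eventually_gt_atTop 0] with n hn hn0
    have hn0' : (0 : ℝ) < n := by exact_mod_cast hn0
    rw [one_div, inv_mul_lt_iff₀ hn0'] at hn
    have : Nonempty {φ : (H.pow n).Sphere // 1 - ε / 2 ≤ ‖inner ℂ φ.1 (tpow ψ n).1‖ ^ 2} :=
      ⟨tpow ψ n, by simp [inner_self_eq_norm_sq_to_K, (tpow ψ n).2, hε2.le]⟩
    obtain ⟨⟨φ, hφ⟩, hφ'⟩ := exists_lt_of_ciInf_lt hn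
    obtain ⟨z, hz, hz'⟩ := exists_phase φ (tpow ψ n)
    exact ⟨phase z hz φ, by linarith, (hE.phase_le z hz φ).trans hφ'.le⟩
  · intro h
    refine le_of_forall_gt_imp_ge_of_dense fun s hs => ?_
    refine le_of_tendsto hlim ?_
    filter_upwards [self_mem_nhdsWithin] with ε hε
    have hε : (0 : ℝ) < ε := hε
    refine Filter.limsup_le_of_le
      (Filter.isBoundedUnder_of ⟨_, fun n => (hC ε hε.le n).1⟩).isCoboundedUnder_le ?_
    filter_upwards [h ε hε s hs, Filter.eventually_gt_atTop 0] with n ⟨χ, hχ, hχ'⟩ hn0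
    have hn0' : (0 : ℝ) < n := by exact_mod_cast hn0
    rw [one_div, inv_mul_le_iff₀ hn0']
    refine le_trans ?_ hχ'
    exact ciInf_le (f := fun φ : {φ : (H.pow n).Sphere // 1 - ε ≤
        ‖inner ℂ φ.1 (tpow ψ n).1‖ ^ 2} => E _ φ.1)
      ⟨0, by rintro _ ⟨_, rfl⟩; exact hE.nonneg _ _⟩ ⟨χ, one_sub_le_norm_inner_sq hχ⟩

theorem MemFsub.smoothingLimit_nonneg (hk : 1 ≤ k) {E : EntMeasure k} (hE : MemFsub E)
    (H : Space k) (ψ : H.Sphere) : 0 ≤ smoothingLimit E H ψ := by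
  obtain ⟨⟨C, hC⟩, -⟩ := hE.tendsto_smoothedRate hk H ψ
  refine le_trans ?_ (hE.smoothedRate_le_smoothingLimit hk H ψ one_pos)
  refine Filter.le_limsup_of_frequently_le
    (Filter.Eventually.frequently (Filter.Eventually.of_forall fun n => (hC 1 zero_le_one n).1)) ?_
  exact Filter.isBoundedUnder_of ⟨_, fun n => (hC 1 zero_le_one n).2⟩

/-! ### The law of large numbers for independent outcomes -/

theorem sum_prod_eq_one {Y : Type} [Fintype Y] {p : Y → ℝ} (hp : ∑ y, p y = 1) (n : ℕ) :
    ∑ w : Fin n → Y, ∏ m, p (w m) = 1 := by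
  rw [← Fintype.sum_pow, hp, one_pow]

theorem sum_fin_succ {Y : Type} [Fintype Y] {n : ℕ} (F : (Fin (n + 1) → Y) → ℝ) :
    ∑ w, F w = ∑ y, ∑ w : Fin n → Y, F (Fin.cons y w) := by
  rw [← Fintype.sum_prod_type']
  exact (Equiv.sum_comp (Fin.consEquiv fun _ => Y) F).symm

/-- The variance of a sum of independent centred variables. -/
theorem sum_prod_mul_sum_sq {Y : Type} [Fintype Y] {p f : Y → ℝ} (hp : ∑ y, p y = 1)
    (hf : ∑ y, p y * f y = 0) (n : ℕ) :
    (∑ w : Fin n → Y, (∏ m, p (w m)) * ∑ m, f (w m)) = 0 ∧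
    ∑ w : Fin n → Y, (∏ m, p (w m)) * (∑ m, f (w m)) ^ 2 = n * ∑ y, p y * f y ^ 2 := by
  induction n with
  | zero => simp
  | succ n ih =>
    obtain ⟨ih1, ih2⟩ := ih
    have h0 := sum_prod_eq_one hp n
    have e1 : ∀ y (w : Fin n → Y), (∏ m, p ((Fin.cons y w : Fin (n + 1) → Y) m)) =
        p y * ∏ m, p (w m) := fun y w => by simp [Fin.prod_univ_succ]
    have e2 : ∀ y (w : Fin n → Y), (∑ m, f ((Fin.cons y w : Fin (n + 1) → Y) m)) =
        f y + ∑ m, f (w m) := fun y w => by simp [Fin.sum_univ_succ]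
    constructor
    · rw [sum_fin_succ]
      simp only [e1, e2]
      have : ∀ y, ∑ w : Fin n → Y, p y * (∏ m, p (w m)) * (f y + ∑ m, f (w m)) = p y * f y := by
        intro y
        have : ∀ w : Fin n → Y, p y * (∏ m, p (w m)) * (f y + ∑ m, f (w m)) =
            p y * f y * (∏ m, p (w m)) + p y * ((∏ m, p (w m)) * ∑ m, f (w m)) := fun w => by ring
        simp only [this]
        rw [Finset.sum_add_distrib, ← Finset.mul_sum, ← Finset.mul_sum, h0, ih1]
        ring
      simp only [this, hf]
    · rw [sum_fin_succ]
      simp only [e1, e2]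
      have : ∀ y, ∑ w : Fin n → Y, p y * (∏ m, p (w m)) * (f y + ∑ m, f (w m)) ^ 2 =
          p y * f y ^ 2 + p y * (n * ∑ y, p y * f y ^ 2) := by
        intro y
        have : ∀ w : Fin n → Y, p y * (∏ m, p (w m)) * (f y + ∑ m, f (w m)) ^ 2 =
            p y * f y ^ 2 * (∏ m, p (w m)) + 2 * p y * f y * ((∏ m, p (w m)) * ∑ m, f (w m)) +
            p y * ((∏ m, p (w m)) * (∑ m, f (w m)) ^ 2) := fun w => by ring
        simp only [this]
        rw [Finset.sum_add_distrib, Finset.sum_add_distrib, ← Finset.mul_sum, ← Finset.mul_sum,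
          ← Finset.mul_sum, h0, ih1, ih2]
        ring
      simp only [this]
      rw [Finset.sum_add_distrib, ← Finset.sum_mul, hp]
      push_cast
      ring

open Classical in
/-- Chebyshev's bound for the probability that an event `A` of probability `P` occurs less than
`n (P - δ)` times in `n` independent trials. -/
theorem sum_atypical_le {Y : Type} [Fintype Y] {p : Y → ℝ} (hp0 : ∀ y, 0 ≤ p y)
    (hp : ∑ y, p y = 1) (A : Finset Y) {δ : ℝ} (hδ : 0 < δ) {n : ℕ} (hn : 0 < n) :
    ∑ w : Fin n → Y with ((Finset.univ.filter fun m => w m ∈ A).card : ℝ) <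
      n * (∑ y ∈ A, p y - δ), ∏ m, p (w m) ≤ 1 / (n * δ ^ 2) := by
  set P := ∑ y ∈ A, p y with hP
  set f : Y → ℝ := fun y => (if y ∈ A then 1 else 0) - P with hf
  have hPA : ∑ y, p y * (if y ∈ A then 1 else 0) = P := by simp [hP, Finset.sum_ite_mem]
  have hf0 : ∑ y, p y * f y = 0 := by
    simp only [hf, mul_sub, Finset.sum_sub_distrib, ← Finset.sum_mul, hPA, hp]
    ring
  have hP0 : 0 ≤ P := Finset.sum_nonneg fun y _ => hp0 y
  have hP1 : P ≤ 1 := by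
    rw [← hp]
    exact Finset.sum_le_sum_of_subset_of_nonneg (Finset.subset_univ A) fun y _ _ => hp0 y
  have hf1 : ∀ y, f y ^ 2 ≤ 1 := fun y => by
    simp only [hf]
    split_ifs <;> nlinarith
  have hvar : ∑ y, p y * f y ^ 2 ≤ 1 := by
    rw [← hp]
    exact Finset.sum_le_sum fun y _ => mul_le_of_le_one_right (hp0 y) (hf1 y)
  have hn' : (0 : ℝ) < n := by exact_mod_cast hn
  have hprod : ∀ w : Fin n → Y, 0 ≤ ∏ m, p (w m) := fun w =>
    Finset.prod_nonneg fun m _ => hp0 _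
  have hcount : ∀ w : Fin n → Y, ∑ m, f (w m) =
      (Finset.univ.filter fun m => w m ∈ A).card - n * P := fun w => by
    simp [hf, Finset.sum_sub_distrib]
  have h := (sum_prod_mul_sum_sq hp hf0 n).2
  rw [le_div_iff₀ (by positivity)]
  have h1 : (∑ w : Fin n → Y with ((Finset.univ.filter fun m => w m ∈ A).card : ℝ) <
      n * (P - δ), ∏ m, p (w m)) * (n * δ) ^ 2 ≤ n := by
    rw [Finset.sum_mul]
    calc _ ≤ ∑ w : Fin n → Y with ((Finset.univ.filter fun m => w m ∈ A).card : ℝ) <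
          n * (P - δ), (∏ m, p (w m)) * (∑ m, f (w m)) ^ 2 := by
          refine Finset.sum_le_sum fun w hw => mul_le_mul_of_nonneg_left ?_ (hprod w)
          have hw' := (Finset.mem_filter.mp hw).2
          rw [hcount]
          have : 0 < n * δ := by positivity
          nlinarith
      _ ≤ ∑ w : Fin n → Y, (∏ m, p (w m)) * (∑ m, f (w m)) ^ 2 :=
          Finset.sum_le_sum_of_subset_of_nonneg (Finset.subset_univ _) fun w _ _ =>
            mul_nonneg (hprod w) (sq_nonneg _)
      _ ≤ n := by rw [h]; exact mul_le_of_le_one_right hn'.le hvar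
  have h2 : ∀ S : ℝ, S * (n * δ) ^ 2 ≤ n → S * (n * δ ^ 2) ≤ 1 := fun S hS => by
    have : n * (S * (n * δ ^ 2)) ≤ n * 1 := by linarith
    exact le_of_mul_le_mul_left this hn'
  exact h2 _ h1

/-! ### Many copies of a transformation -/

theorem sum_biUnion_le {X W : Type} [Fintype X] [Fintype W] [DecidableEq W]
    (B : X → Finset W) {F : W → ℝ}
    (hF : ∀ w, 0 ≤ F w) : ∑ w ∈ Finset.univ.biUnion B, F w ≤ ∑ x, ∑ w ∈ B x, F w := by
  have h : ∀ x, ∑ w ∈ B x, F w = ∑ w, if w ∈ B x then F w else 0 := fun x => by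
    simp [Finset.sum_ite_mem]
  simp_rw [h]
  rw [Finset.sum_comm, ← Finset.sum_subset (Finset.subset_univ (Finset.univ.biUnion B))]
  · refine Finset.sum_le_sum fun w hw => ?_
    obtain ⟨x, -, hx⟩ := Finset.mem_biUnion.mp hw
    calc F w = if w ∈ B x then F w else 0 := by rw [if_pos hx]
      _ ≤ _ := Finset.single_le_sum (f := fun x => if w ∈ B x then F w else 0)
          (fun y _ => by split_ifs <;> simp [hF]) (Finset.mem_univ x)
  · intro w _ hw
    refine Finset.sum_eq_zero fun x _ => if_neg fun hx => hw ?_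
    exact Finset.mem_biUnion.mpr ⟨x, Finset.mem_univ x, hx⟩

open Classical in
/-- A word in which no letter occurs more often than in `w` is, up to order, a subword of `w`. -/
theorem exists_embedding {J I X : Type} [Fintype J] [Fintype I] (v : J → X) (w : I → X)
    (h : ∀ x, (Finset.univ.filter fun j => v j = x).card ≤
      (Finset.univ.filter fun i => w i = x).card) :
    ∃ σ : J ↪ I, ∀ j, w (σ j) = v j := by
  have : ∀ x, Nonempty ({j // v j = x} ↪ {i // w i = x}) := fun x => by
    apply Function.Embedding.nonempty_of_card_le
    simpa [Fintype.card_subtype] using h x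
  have f := fun x => (this x).some
  refine ⟨⟨fun j => (f (v j) ⟨j, rfl⟩).1, fun j j' hj => ?_⟩, fun j => (f (v j) ⟨j, rfl⟩).2⟩
  have hv : v j = v j' := by
    rw [← (f (v j) ⟨j, rfl⟩).2, ← (f (v j') ⟨j', rfl⟩).2]
    exact congrArg w hj
  have h1 : f (v j) ⟨j, rfl⟩ = f (v j) ⟨j', hv.symm⟩ := by
    apply Subtype.ext
    refine hj.trans ?_
    have : ∀ x (hx : v j' = x), (f (v j') ⟨j', rfl⟩).1 = (f x ⟨j', hx⟩).1 := by
      rintro x rfl; rfl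
    exact this _ hv.symm
  exact congrArg Subtype.val ((f (v j)).injective h1)

section Split

variable {K : Space k} {J I L : Type} [Fintype J] [Fintype I] [Fintype L]
  [DecidableEq J] [DecidableEq I] [DecidableEq L]

/-- The identification of `K^{⊗ L}` with `K^{⊗ J} ⊗ K^{⊗ I}` along a bijection of `J ⊕ I` with
`L`. -/
def splitEquiv (K : Space k) (τ : J ⊕ I ≃ L) (i : Fin k) : (Space.pi fun _ : L => K).ι i ≃
    ((Space.pi fun _ : J => K).tensor (Space.pi fun _ : I => K)).ι i where
  toFun f := (fun j => f (τ (.inl j)), fun j => f (τ (.inr j)))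
  invFun p l := Sum.elim p.1 p.2 (τ.symm l)
  left_inv f := by
    funext l
    obtain ⟨q, rfl⟩ := τ.surjective l
    rcases q with j | j <;> simp
  right_inv p := by
    refine Prod.ext (funext fun j => ?_) (funext fun j => ?_)
    · change Sum.elim p.1 p.2 (τ.symm (τ (.inl j))) = _
      rw [Equiv.symm_apply_apply]; rfl
    · change Sum.elim p.1 p.2 (τ.symm (τ (.inr j))) = _
      rw [Equiv.symm_apply_apply]; rfl

theorem relabel_splitEquiv (τ : J ⊕ I ≃ L) (ψ : L → K.Sphere) :
    relabel (splitEquiv K τ) (prod ψ) =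
      tensor (prod fun j => ψ (τ (.inl j))) (prod fun i => ψ (τ (.inr i))) := by
  apply Subtype.ext
  ext x
  change (∏ l, (ψ l).1 fun i => Sum.elim (x i).1 (x i).2 (τ.symm l)) =
    (∏ j, (ψ (τ (.inl j))).1 fun i => (x i).1 j) * ∏ j, (ψ (τ (.inr j))).1 fun i => (x i).2 j
  rw [← Equiv.prod_comp τ, Fintype.prod_sum_type]
  simp only [Equiv.symm_apply_apply]
  rfl

end Split

open Classical in
/-- If `ψ` is transformed into `φ_x` with probability `P x`, then for large `n` an approximation of
`ψ^{⊗ n}` yields, at almost the same value of `E`, an approximation of every product of the `φ_x`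
in which each `φ_x` occurs a bit less often than `n P x` times. -/
theorem MemFsub.exists_approx_word (hk : 1 ≤ k) {E : EntMeasure k} (hE : MemFsub E)
    {H K : Space k} {X : Type} [Fintype X] {P : X → ℝ} {ψ : H.Sphere} {φ : X → K.Sphere}
    (hP : ∑ x, P x = 1) (h : LOCC ψ P φ) {δ s ε' : ℝ} (hδ : 0 < δ) (hs : 1 < s) (hε' : 0 < ε') :
    ∃ κ > 0, ∃ n₀ : ℕ, ∀ n ≥ n₀, ∀ {J : Type} [Fintype J] [DecidableEq J] (v : J → X)
      (_ : ∀ x, (Finset.univ.filter fun j => v j = x).card = 0 ∨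
        ((Finset.univ.filter fun j => v j = x).card : ℝ) ≤ n * (P x - δ))
      (χ : (H.pow n).Sphere) (_ : ‖χ.1 - (tpow ψ n).1‖ ^ 2 ≤ κ) (T : ℝ) (_ : 0 < T)
      (_ : E _ χ ≤ T), ∃ χ' : (Space.pi fun _ : J => K).Sphere,
        ‖χ'.1 - (prod fun j => φ (v j)).1‖ ^ 2 ≤ ε' ∧ E _ χ' ≤ s * T := by
  have hs' : 1 < √s := by rw [Real.lt_sqrt zero_le_one]; simpa using hs
  have hss : √s * √s = s := Real.mul_self_sqrt (by linarith)
  obtain ⟨κ₂, hκ₂, hdisc⟩ := hE.exists_discard hk hs' hε'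
  obtain ⟨κ, hκ, hout⟩ := hE.exists_outcome hs' hκ₂
  obtain ⟨Y, _, M, g, c, hM, hMψ, hc⟩ := h.exists_instr hk hP
  set p : Y → ℝ := fun y => ‖c y‖ ^ 2 with hp_def
  have hp0 : ∀ y, 0 ≤ p y := fun y => by positivity
  have hp : ∑ y, p y = 1 := by
    rw [← Finset.sum_fiberwise _ g, ← hP]
    exact Finset.sum_congr rfl fun x _ => hc x
  obtain ⟨n₁, hn₁⟩ := exists_nat_gt (Fintype.card X / (δ ^ 2 * κ))
  refine ⟨κ, hκ, n₁ + 1, fun n hn J _ _ v hv χ hχ T hT hET => ?_⟩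
  have hn0 : 0 < n := by omega
  have hn0' : (0 : ℝ) < n := by exact_mod_cast hn0
  obtain ⟨N, hN, hNψ⟩ := exists_instr_pow hk hM n
  -- A word of outcomes is bad if some `x` occurs too rarely in it.
  let A : X → Finset Y := fun x => Finset.univ.filter fun y => g y = x
  let bad : X → Finset (Fin n → Y) := fun x => Finset.univ.filter fun w =>
    ((Finset.univ.filter fun m => w m ∈ A x).card : ℝ) < n * (∑ y ∈ A x, p y - δ)
  have hB : ∑ w ∈ Finset.univ.biUnion bad, ‖∏ m, c (w m)‖ ^ 2 ≤ κ := by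
    simp only [norm_prod, ← Finset.prod_pow]
    calc _ ≤ ∑ x, ∑ w ∈ bad x, ∏ m, p (w m) :=
          sum_biUnion_le _ fun w => Finset.prod_nonneg fun m _ => hp0 _
      _ ≤ ∑ x : X, 1 / (n * δ ^ 2) :=
          Finset.sum_le_sum fun x _ => sum_atypical_le hp0 hp (A x) hδ hn0
      _ ≤ κ := by
          rw [Finset.sum_const, Finset.card_univ, nsmul_eq_mul, mul_one_div,
            div_le_iff₀ (by positivity)]
          have h1 : (n₁ : ℝ) ≤ n := by exact_mod_cast (by omega : n₁ ≤ n)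
          have h2 := hn₁.le.trans h1
          rw [div_le_iff₀ (by positivity)] at h2
          linarith
  have hNψ' : ∀ w, act (N w) (tpow ψ n).1 =
      (∏ m, c (w m)) • (prod (fun m : Fin n => φ (g (w m))) : (K.pow n).Sphere).1 := by
    intro w
    refine (hNψ w fun _ => ψ.1).trans ?_
    simp only [hMψ]
    exact prodVec_smul _ _
  obtain ⟨w, hw, χ₁, hχ₁, hEχ₁⟩ := hout hN (tpow ψ n) χ _ _ hNψ' _ hB hχ T hT hET
  have hcard : ∀ x, (Finset.univ.filter fun j => v j = x).card ≤
      (Finset.univ.filter fun m => g (w m) = x).card := by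
    intro x
    rcases hv x with h0 | h0
    · omega
    · have hwx : w ∉ bad x := fun hx => hw (Finset.mem_biUnion.mpr ⟨x, Finset.mem_univ x, hx⟩)
      simp only [bad, Finset.mem_filter, Finset.mem_univ, true_and, not_lt] at hwx
      rw [show ∑ y ∈ A x, p y = P x from hc x] at hwx
      have := h0.trans hwx
      simpa [A] using this
  obtain ⟨σ, hσ⟩ := exists_embedding v (fun m => g (w m)) hcard
  let τ : J ⊕ {m : Fin n // m ∉ Set.range σ} ≃ Fin n :=
    (Equiv.sumCongr (Equiv.ofInjective σ σ.injective) (Equiv.refl _)).trans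
      (Equiv.sumCompl fun m => m ∈ Set.range σ)
  have hτ : ∀ j, g (w (τ (.inl j))) = v j := hσ
  have hsplit := relabel_splitEquiv τ fun m => φ (g (w m))
  simp only [hτ] at hsplit
  obtain ⟨χ₂, hχ₂, hEχ₂⟩ := hdisc _ _ (relabel (splitEquiv K τ) χ₁) (by
      rw [← hsplit]
      exact (congrArg (· ^ 2) (norm_relabel_sub _ _ _)).trans_le hχ₁)
    (√s * T) (by positivity) ((hE.relabel_le hk _ χ₁).trans hEχ₁)
  exact ⟨χ₂, hχ₂, by rwa [← mul_assoc, hss] at hEχ₂⟩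

/-! ### Weak monotonicity -/

theorem MemFsub.weaklyMonotone_smoothingLimit (hk : 1 ≤ k) {E : EntMeasure k} (hE : MemFsub E) :
    WeaklyMonotone (smoothingLimit E) := by
  classical
  intro H K X _ P ψ φ hP0 hP1 h x
  have hΦ := hE.smoothingLimit_nonneg hk H ψ
  rcases (hP0 x).eq_or_lt with hp | hp
  · rw [← hp, zero_mul]; exact hΦ
  rw [mul_comm, ← le_div_iff₀ hp, hE.smoothingLimit_le_iff hk]
  intro ε hε s hs
  rw [gt_iff_lt, div_lt_iff₀ hp] at hs
  -- Three losses have to fit below `s P(x)`: the rate `s' > Φ(ψ)`, the guaranteed share `q < P(x)`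
  -- of copies of `φ_x`, and the factor `f > 1` of the approximation; finally `f s' < q s`.
  obtain ⟨s', hs', hs's⟩ := exists_between hs
  have hs'0 : 0 < s' := hΦ.trans_lt hs'
  have hs0 : 0 < s := by
    by_contra hcon
    nlinarith
  obtain ⟨q, hq, hqp⟩ := exists_between ((div_lt_iff₀' hs0).mpr hs's)
  rw [div_lt_iff₀ hs0] at hq
  have hq0 : 0 < q := by
    by_contra hcon
    nlinarith
  obtain ⟨f, hf, hfq⟩ := exists_between ((one_lt_div hs'0).mpr hq)
  rw [lt_div_iff₀ hs'0] at hfq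
  obtain ⟨κ, hκ, n₀, hn₀⟩ := hE.exists_approx_word hk hP1 h (δ := P x - q) (sub_pos.mpr hqp) hf hε
  have hev := (hE.smoothingLimit_le_iff hk H ψ _).mp le_rfl κ hκ s' hs'
  have hlim : Filter.Tendsto (fun m : ℕ => ⌈(m : ℝ) / q⌉₊) Filter.atTop Filter.atTop :=
    tendsto_nat_ceil_atTop.comp (tendsto_natCast_atTop_atTop.atTop_div_const hq0)
  obtain ⟨m₀, hm₀⟩ := exists_nat_gt (f * s' * q / (q * s - f * s'))
  filter_upwards [hlim.eventually hev, hlim.eventually (Filter.eventually_ge_atTop n₀),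
    Filter.eventually_ge_atTop m₀, Filter.eventually_gt_atTop 0] with m hχ hn hm hm0
  set n := ⌈(m : ℝ) / q⌉₊ with hn_def
  obtain ⟨χ, hχ, hEχ⟩ := hχ
  have hmpos : (0 : ℝ) < m := by exact_mod_cast hm0
  have hnm : (m : ℝ) ≤ n * q := (div_le_iff₀ hq0).mp (Nat.le_ceil _)
  have hnm' : (n : ℝ) < m / q + 1 := Nat.ceil_lt_add_one (by positivity)
  have hn0 : (0 : ℝ) < n := by
    by_contra hcon
    nlinarith
  obtain ⟨χ', hχ', hEχ'⟩ := hn₀ n hn (J := Fin m) (fun _ => x) (fun x' => by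
    by_cases hx : x = x'
    · right
      subst hx
      simpa using hnm
    · left
      simp [hx]) χ hχ (n * s') (by positivity) hEχ
  refine ⟨χ', hχ', hEχ'.trans ?_⟩
  have hd : 0 < q * s - f * s' := by linarith
  have h1 : f * s' * q / (q * s - f * s') ≤ m := hm₀.le.trans (by exact_mod_cast hm)
  rw [div_le_iff₀ hd] at h1
  have h2 : (n : ℝ) * q ≤ m + q := by
    have := mul_le_mul_of_nonneg_right hnm'.le hq0.le
    rwa [add_mul, div_mul_cancel₀ _ hq0.ne', one_mul] at this
  have hfs : 0 < f * s' := by positivity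
  have h3 : f * (n * s') * q ≤ m * s * q := by
    calc f * (n * s') * q = f * s' * (n * q) := by ring
      _ ≤ f * s' * (m + q) := mul_le_mul_of_nonneg_left h2 hfs.le
      _ ≤ m * s * q := by linarith
  exact le_of_mul_le_mul_right h3 hq0

/-! ### Monotonicity on average of an additive smoothing limit -/

/-- The identification of `H 0 ⊗ ⨂ⱼ H (j + 1)` with `⨂ⱼ H j`. -/
def consEquiv {n : ℕ} (H : Fin (n + 1) → Space k) (i : Fin k) :
    ((H 0).tensor (Space.pi fun j : Fin n => H j.succ)).ι i ≃ (Space.pi H).ι i :=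
  Fin.consEquiv fun j => (H j).ι i

theorem relabel_cons {n : ℕ} {H : Fin (n + 1) → Space k} (ψ : ∀ j, (H j).Sphere) :
    relabel (consEquiv H) (tensor (ψ 0) (prod fun j : Fin n => ψ j.succ)) = prod ψ := by
  apply Subtype.ext
  ext x
  exact (Fin.prod_univ_succ fun m => (ψ m).1 fun i => x i m).symm

theorem relabel_symm {H K : Space k} (e : ∀ j, H.ι j ≃ K.ι j) (ψ : H.Sphere) :
    relabel (fun j => (e j).symm) (relabel e ψ) = ψ := by
  apply Subtype.ext
  ext x
  exact congrArg ψ.1 (funext fun j => (e j).symm_apply_apply (x j))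

theorem WeaklyMonotone.relabel_le (hk : 1 ≤ k) {F : EntMeasure k} (hF : WeaklyMonotone F)
    {H K : Space k} (e : ∀ j, H.ι j ≃ K.ι j) (ψ : H.Sphere) : F K (relabel e ψ) ≤ F H ψ := by
  simpa using hF H K Unit (fun _ => 1) ψ _ (by simp) (by simp) (LOCC_relabel hk e ψ) ()

/-- Only one inequality is stated: additivity on a product with no factors is not needed, as
non-negativity suffices there. -/
theorem Additive.sum_le_prod (hk : 1 ≤ k) {F : EntMeasure k} (hF : Additive F)
    (hmon : WeaklyMonotone F) (hnonneg : ∀ H ψ, 0 ≤ F H ψ) {n : ℕ} {H : Fin n → Space k}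
    (ψ : ∀ j, (H j).Sphere) : ∑ j, F (H j) (ψ j) ≤ F (Space.pi H) (prod ψ) := by
  induction n with
  | zero => simpa using hnonneg _ _
  | succ n ih =>
    rw [Fin.sum_univ_succ]
    calc _ ≤ F (H 0) (ψ 0) + F _ (prod fun j : Fin n => ψ j.succ) := by
          gcongr
          exact ih fun j => ψ j.succ
      _ = F _ (tensor (ψ 0) (prod fun j : Fin n => ψ j.succ)) := (hF _ _ _ _).symm
      _ = F _ (relabel (fun i => (consEquiv H i).symm) (prod ψ)) := by
          rw [← relabel_cons, relabel_symm]
      _ ≤ _ := hmon.relabel_le hk _ _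

theorem relabel_curry {K : Space k} {t m : ℕ} (ψ : Fin m → K.Sphere) :
    relabel (H := Space.pi fun _ : Fin t × Fin m => K)
      (K := (Space.pi fun _ : Fin m => K).pow t)
      (fun i => Equiv.curry (Fin t) (Fin m) (K.ι i)) (prod fun p => ψ p.2) = tpow (prod ψ) t := by
  apply Subtype.ext
  ext x
  exact Fintype.prod_prod_type (f := fun p : Fin t × Fin m => (ψ p.2).1 fun i => x i p.1 p.2)

open Classical in
/-- A product of the `φ_x` in which each of them occurs less often than in `N` copies of the
ensemble has a smoothing limit of at most `N` times that of `ψ`. -/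
theorem MemFsub.smoothingLimit_prod_le (hk : 1 ≤ k) {E : EntMeasure k} (hE : MemFsub E)
    {H K : Space k} {X : Type} [Fintype X] {P : X → ℝ} {ψ : H.Sphere} {φ : X → K.Sphere}
    (hP : ∑ x, P x = 1) (h : LOCC ψ P φ) {N m : ℕ} (hN : 0 < N) (v : Fin m → X)
    (hv : ∀ x, (Finset.univ.filter fun j => v j = x).card = 0 ∨
      ((Finset.univ.filter fun j => v j = x).card : ℝ) < N * P x) :
    smoothingLimit E _ (prod fun j => φ (v j)) ≤ N * smoothingLimit E H ψ := by
  have hΦ := hE.smoothingLimit_nonneg hk H ψ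
  have hN' : (0 : ℝ) < N := by exact_mod_cast hN
  obtain ⟨δ, hδ, hδv⟩ : ∃ δ > (0 : ℝ), ∀ x, (Finset.univ.filter fun j => v j = x).card = 0 ∨
      ((Finset.univ.filter fun j => v j = x).card : ℝ) ≤ N * (P x - δ) := by
    have : ∀ᶠ δ : ℝ in nhdsWithin 0 (Set.Ioi 0), ∀ x,
        (Finset.univ.filter fun j => v j = x).card = 0 ∨
        ((Finset.univ.filter fun j => v j = x).card : ℝ) ≤ N * (P x - δ) := by
      rw [Filter.eventually_all]
      intro x
      rcases hv x with h0 | h0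
      · exact Filter.Eventually.of_forall fun _ => .inl h0
      · have hc : Continuous fun δ : ℝ => N * (P x - δ) := by fun_prop
        have : Filter.Tendsto (fun δ : ℝ => N * (P x - δ)) (nhdsWithin 0 (Set.Ioi 0))
            (nhds (N * P x)) := by
          simpa using (hc.tendsto 0).mono_left nhdsWithin_le_nhds
        filter_upwards [this.eventually_const_lt h0] with δ hδ using .inr hδ.le
    obtain ⟨δ, h1, h2⟩ := (this.and self_mem_nhdsWithin).exists
    exact ⟨δ, h2, h1⟩
  rw [hE.smoothingLimit_le_iff hk]
  intro ε hε s hs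
  obtain ⟨s', hs', hs's⟩ := exists_between ((lt_div_iff₀' hN').mpr hs)
  have hs'0 : 0 < s' := hΦ.trans_lt hs'
  obtain ⟨κ, hκ, n₀, hn₀⟩ := hE.exists_approx_word hk hP h hδ
    ((one_lt_div hs'0).mpr hs's) hε
  have hev := (hE.smoothingLimit_le_iff hk H ψ _).mp le_rfl κ hκ s' hs'
  have hlim : Filter.Tendsto (fun t : ℕ => N * t) Filter.atTop Filter.atTop :=
    Filter.tendsto_id.const_mul_atTop' hN
  filter_upwards [hlim.eventually hev, hlim.eventually (Filter.eventually_ge_atTop n₀),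
    Filter.eventually_gt_atTop 0] with t ⟨χ, hχ, hEχ⟩ hn ht
  have ht' : (0 : ℝ) < t := by exact_mod_cast ht
  have hcard : ∀ x, (Finset.univ.filter fun p : Fin t × Fin m => v p.2 = x).card =
      t * (Finset.univ.filter fun j => v j = x).card := fun x => by
    have : (Finset.univ.filter fun p : Fin t × Fin m => v p.2 = x) =
        Finset.univ ×ˢ (Finset.univ.filter fun j => v j = x) := by
      ext p; simp
    rw [this, Finset.card_product, Finset.card_univ, Fintype.card_fin]
  obtain ⟨χ', hχ', hEχ'⟩ := hn₀ (N * t) hn (J := Fin t × Fin m) (fun p => v p.2) (fun x => by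
    rw [hcard]
    rcases hδv x with h0 | h0
    · left; rw [h0, mul_zero]
    · right
      push_cast
      calc _ ≤ (t : ℝ) * (N * (P x - δ)) := mul_le_mul_of_nonneg_left h0 ht'.le
        _ = _ := by ring) χ hχ _ (by positivity : 0 < ((N * t : ℕ) : ℝ) * s') hEχ
  refine ⟨relabel (fun i => Equiv.curry (Fin t) (Fin m) (K.ι i)) χ', ?_,
    (hE.relabel_le hk _ χ').trans (hEχ'.trans (le_of_eq ?_))⟩
  · rw [← relabel_curry]
    exact (congrArg (· ^ 2) (norm_relabel_sub _ _ _)).trans_le hχ'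
  · push_cast
    field_simp

theorem MemFsub.monotoneOnAverage_smoothingLimit (hk : 1 ≤ k) {E : EntMeasure k} (hE : MemFsub E)
    (hadd : Additive (smoothingLimit E)) : MonotoneOnAverage (smoothingLimit E) := by
  classical
  intro H K X _ P ψ φ hP0 hP1 h
  set Φ := smoothingLimit E with hΦ
  have key : ∀ N : ℕ, 0 < N → (N : ℝ) * (∑ x, P x * Φ K (φ x) - Φ H ψ) ≤ ∑ x, Φ K (φ x) := by
    intro N hN
    -- The largest integer below `N P x`, or zero if `P x = 0`.
    let a : X → ℕ := fun x => ⌈(N : ℝ) * P x⌉₊ - 1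
    let e := Fintype.equivFin (Σ x, Fin (a x))
    let v : Fin (Fintype.card (Σ x, Fin (a x))) → X := fun j => (e.symm j).1
    have hcard : ∀ x, (Finset.univ.filter fun j => v j = x).card = a x := fun x => by
      rw [← Fintype.card_subtype, ← Fintype.card_fin (a x)]
      refine Fintype.card_congr (((e.symm.subtypeEquiv fun j => Iff.rfl).trans
        (Equiv.sigmaSubtype x)))
    have hle := hE.smoothingLimit_prod_le hk hP1 h hN v (fun x => by
      rw [hcard]
      rcases (hP0 x).eq_or_lt with hp | hp
      · left
        simp [a, ← hp]
      · right
        have hNP : (0 : ℝ) < N * P x := mul_pos (by exact_mod_cast hN) hp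
        have h1 : 1 ≤ ⌈(N : ℝ) * P x⌉₊ := Nat.one_le_ceil_iff.mpr hNP
        have h2 := Nat.ceil_lt_add_one hNP.le
        simp only [a]
        push_cast [Nat.cast_sub h1]
        linarith)
    have hge := hadd.sum_le_prod hk (hE.weaklyMonotone_smoothingLimit hk)
      (hE.smoothingLimit_nonneg hk) fun j => φ (v j)
    have hsum : ∑ j, Φ K (φ (v j)) = ∑ x, a x * Φ K (φ x) := by
      rw [← Equiv.sum_comp e, Fintype.sum_sigma]
      simp [v]
    have ha : ∀ x, (N : ℝ) * P x - 1 ≤ a x := fun x => by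
      have h1 := Nat.le_ceil ((N : ℝ) * P x)
      have h2 : ⌈(N : ℝ) * P x⌉₊ ≤ a x + 1 := by simp only [a]; omega
      have h3 : (⌈(N : ℝ) * P x⌉₊ : ℝ) ≤ a x + 1 := by exact_mod_cast h2
      linarith
    have h4 : ∑ x, ((N : ℝ) * P x - 1) * Φ K (φ x) ≤ N * Φ H ψ :=
      calc _ ≤ ∑ x, a x * Φ K (φ x) := Finset.sum_le_sum fun x _ =>
            mul_le_mul_of_nonneg_right (ha x) (hE.smoothingLimit_nonneg hk _ _)
        _ ≤ _ := by rw [← hsum]; exact hge.trans hle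
    have h5 : ∑ x, ((N : ℝ) * P x - 1) * Φ K (φ x) =
        N * ∑ x, P x * Φ K (φ x) - ∑ x, Φ K (φ x) := by
      rw [Finset.mul_sum, ← Finset.sum_sub_distrib]
      exact Finset.sum_congr rfl fun x _ => by ring
    rw [h5] at h4
    linarith
  by_contra hcon
  rw [not_le, ← sub_pos] at hcon
  obtain ⟨N, hN⟩ := exists_nat_gt ((∑ x, Φ K (φ x)) / (∑ x, P x * Φ K (φ x) - Φ H ψ))
  rw [div_lt_iff₀ hcon] at hN
  have hN0 : 0 < N := by
    rcases Nat.eq_zero_or_pos N with rfl | h0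
    · have : 0 ≤ ∑ x, Φ K (φ x) := Finset.sum_nonneg fun x _ => hE.smoothingLimit_nonneg hk _ _
      simp at hN
      linarith
    · exact h0
  exact absurd (key N hN0) (not_le.mpr hN)

/-! ### Direct sums -/

section DirectSum

variable {l : ℕ} {H : Fin l → Space k}

/-- The label of a basis vector of the summand `j`, as a label for the direct sum. -/
def directSumIdx (j : Fin l) (y : (H j).Idx) : (Space.directSum H).Idx := fun i => ⟨j, y i⟩

theorem directSumVec_mk (hk : 1 ≤ k) (v : ∀ j, (H j).Vec) (j : Fin l) (y : (H j).Idx) :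
    directSumVec v (directSumIdx j y) = v j y := by
  classical
  change (∑ j', ∑ y' : (H j').Idx, _) = _
  rw [Finset.sum_eq_single j, Finset.sum_eq_single y]
  · exact if_pos rfl
  · intro y' _ hy
    refine if_neg fun h => hy ?_
    funext i
    have : (⟨j, y i⟩ : Σ j, (H j).ι i) = ⟨j, y' i⟩ := congrFun h i
    simp only [Sigma.mk.injEq, heq_eq_eq, true_and] at this
    exact this.symm
  · simp
  · intro j' _ hj
    refine Finset.sum_eq_zero fun y' _ => if_neg fun h => hj ?_
    exact (congrArg Sigma.fst (congrFun h ⟨0, hk⟩)).symm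
  · simp

theorem directSumVec_eq_zero (v : ∀ j, (H j).Vec) {x : (Space.directSum H).Idx} {i i' : Fin k}
    (h : (x i).1 ≠ (x i').1) : directSumVec v x = 0 := by
  classical
  change (∑ j', ∑ y' : (H j').Idx, _) = _
  refine Finset.sum_eq_zero fun j _ => Finset.sum_eq_zero fun y _ => if_neg ?_
  rintro rfl
  exact h rfl

/-- A label of the direct sum either belongs to one summand or is mixed; at a mixed label every
direct sum of vectors vanishes. -/
theorem directSum_idx_cases (hk : 1 ≤ k) (x : (Space.directSum H).Idx) :
    (∃ (j : Fin l) (y : (H j).Idx), x = directSumIdx j y) ∨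
      ∃ i i', (x i).1 ≠ (x i').1 := by
  by_cases h : ∃ i i', (x i).1 ≠ (x i').1
  · exact .inr h
  · left
    push Not at h
    have h' := fun i => h i ⟨0, hk⟩
    refine ⟨(x ⟨0, hk⟩).1, fun i => h' i ▸ (x i).2, funext fun i => ?_⟩
    refine Sigma.ext (h' i) ?_
    simp [directSumIdx]

theorem norm_sq_directSumVec_sub (hk : 1 ≤ k) (v w : ∀ j, (H j).Vec) :
    ‖directSumVec v - directSumVec w‖ ^ 2 = ∑ j, ‖v j - w j‖ ^ 2 := by
  simp only [EuclideanSpace.norm_sq_eq]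
  rw [← Fintype.sum_sigma' fun j (y : (H j).Idx) => ‖(v j - w j) y‖ ^ 2]
  symm
  refine Fintype.sum_of_injective
    (fun p : Σ j, (H j).Idx => directSumIdx p.1 p.2) ?_ _ _ ?_ ?_
  · rintro ⟨j, y⟩ ⟨j', y'⟩ h
    obtain rfl : j = j' := congrArg Sigma.fst (congrFun h ⟨0, hk⟩)
    congr 1
    funext i
    have : (⟨j, y i⟩ : Σ j, (H j).ι i) = ⟨j, y' i⟩ := congrFun h i
    simpa using this
  · intro x hx
    rcases directSum_idx_cases hk x with ⟨j, y, rfl⟩ | ⟨i, i', h⟩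
    · exact absurd ⟨⟨j, y⟩, rfl⟩ hx
    · rw [PiLp.sub_apply, directSumVec_eq_zero v h, directSumVec_eq_zero w h]
      simp
  · rintro ⟨j, y⟩
    exact congrArg (fun z => ‖z‖ ^ 2)
      (congrArg₂ (· - ·) (directSumVec_mk hk v j y) (directSumVec_mk hk w j y)).symm

theorem norm_sq_directSumVec (hk : 1 ≤ k) (v : ∀ j, (H j).Vec) :
    ‖directSumVec v‖ ^ 2 = ∑ j, ‖v j‖ ^ 2 := by
  have h0 : directSumVec (fun j => (0 : (H j).Vec)) = 0 := by
    ext x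
    rcases directSum_idx_cases hk x with ⟨j, y, rfl⟩ | ⟨i, i', h⟩
    · exact directSumVec_mk hk _ j y
    · exact directSumVec_eq_zero _ h
  have := norm_sq_directSumVec_sub hk v fun j => 0
  simpa [h0] using this

/-- A tensor power of a direct sum is the direct sum of products over all words, the words being
numbered by `Fin (l ^ n)`. -/
def wordEquiv (H : Fin l → Space k) (n : ℕ) (i : Fin k) :
    (Space.directSum fun t : Fin (l ^ n) =>
      Space.pi fun m => H (finFunctionFinEquiv.symm t m)).ι i ≃ ((Space.directSum H).pow n).ι i :=
  (Equiv.sigmaCongrLeft (β := fun w : Fin n → Fin l => ∀ m, (H (w m)).ι i)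
    finFunctionFinEquiv.symm).trans
    ⟨fun p m => ⟨p.1 m, p.2 m⟩, fun g => ⟨fun m => (g m).1, fun m => (g m).2⟩,
      fun _ => rfl, fun _ => rfl⟩

theorem relabelVec_wordEquiv (hk : 1 ≤ k) (ψ : ∀ j, (H j).Vec) (n : ℕ) :
    relabelVec (wordEquiv H n) (directSumVec fun t : Fin (l ^ n) =>
      prodVec fun m => ψ (finFunctionFinEquiv.symm t m)) = powVec (directSumVec ψ) n := by
  ext x
  obtain ⟨z, rfl⟩ : ∃ z, x = fun i => wordEquiv H n i (z i) :=
    ⟨fun i => (wordEquiv H n i).symm (x i), by simp⟩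
  rw [relabelVec_apply]
  simp only [Equiv.symm_apply_apply]
  rcases directSum_idx_cases hk z with ⟨t, y, rfl⟩ | ⟨i, i', h⟩
  · rw [directSumVec_mk hk]
    change (∏ m, ψ (finFunctionFinEquiv.symm t m) fun i => y i m) =
      ∏ m, directSumVec ψ fun i => wordEquiv H n i ⟨t, y i⟩ m
    refine Finset.prod_congr rfl fun m _ => ?_
    exact (directSumVec_mk hk ψ (finFunctionFinEquiv.symm t m) fun i => y i m).symm
  · rw [directSumVec_eq_zero _ h]
    obtain ⟨m, hm⟩ := Function.ne_iff.mp (finFunctionFinEquiv.symm.injective.ne h)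
    have : powVec (directSumVec ψ) n (fun i => wordEquiv H n i (z i)) = 0 :=
      Finset.prod_eq_zero (Finset.mem_univ m) (directSumVec_eq_zero ψ (i := i) (i' := i') hm)
    exact this.symm

end DirectSum

/-! ### Approximation of product vectors -/

/-- Subadditivity for several factors. The constant is the value of `E` on the empty product, which
need not be zero. -/
theorem MemFsub.prod_le (hk : 1 ≤ k) {E : EntMeasure k} (hE : MemFsub E) :
    ∃ c : ℝ, ∀ {n : ℕ} {H : Fin n → Space k} (ψ : ∀ j, (H j).Sphere),
      E (Space.pi H) (prod ψ) ≤ c + ∑ j, E (H j) (ψ j) := by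
  refine ⟨E (Space.pi fun j : Fin 0 => j.elim0) (prod fun j : Fin 0 => j.elim0), ?_⟩
  intro n
  induction n with
  | zero =>
    intro H ψ
    obtain rfl : H = fun j => j.elim0 := Subsingleton.elim _ _
    rw [show ψ = fun j => j.elim0 from funext fun j => j.elim0]
    simp
  | succ n ih =>
    intro H ψ
    rw [Fin.sum_univ_succ, ← relabel_cons]
    have h1 := hE.relabel_le hk (consEquiv H) (tensor (ψ 0) (prod fun j : Fin n => ψ j.succ))
    have h2 := hE.subadditive _ _ (ψ 0) (prod fun j : Fin n => ψ j.succ)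
    have h3 := ih fun j => ψ j.succ
    linarith

/-- The words over `Fin l` group their letters: the product of the spaces `H (w m)` is the product
over the letters `j` of the powers of `H j`. -/
def groupEquiv {l n : ℕ} (H : Fin l → Space k) (w : Fin n → Fin l) {c : Fin l → ℕ}
    (σ : ∀ j, Fin (c j) ≃ {m // w m = j}) (i : Fin k) :
    (Space.pi fun j => (H j).pow (c j)).ι i ≃ (Space.pi fun m => H (w m)).ι i where
  toFun f m := f (w m) ((σ (w m)).symm ⟨m, rfl⟩)
  invFun g j a := (σ j a).2 ▸ g (σ j a).1
  left_inv f := by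
    funext j a
    have : ∀ q : {m // w m = j}, (q.2 ▸ f (w q.1) ((σ (w q.1)).symm ⟨q.1, rfl⟩) : (H j).ι i) =
        f j ((σ j).symm q) := by
      rintro ⟨m, rfl⟩; rfl
    exact (this (σ j a)).trans (congrArg (f j) ((σ j).symm_apply_apply a))
  right_inv g := by
    funext m
    have : ∀ q : {m' // w m' = w m}, q = ⟨m, rfl⟩ → (q.2 ▸ g q.1 : (H (w m)).ι i) = g m := by
      rintro _ rfl; rfl
    exact this _ ((σ (w m)).apply_symm_apply _)

theorem relabel_groupEquiv {l n : ℕ} {H : Fin l → Space k} (w : Fin n → Fin l) {c : Fin l → ℕ}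
    (σ : ∀ j, Fin (c j) ≃ {m // w m = j}) (u : ∀ j, (H j).Sphere) :
    relabel (groupEquiv H w σ) (prod fun j => tpow (u j) (c j)) = prod fun m => u (w m) := by
  apply Subtype.ext
  ext x
  change (∏ j, ∏ a : Fin (c j), (u j).1 fun i => (σ j a).2 ▸ x i (σ j a).1) =
    ∏ m, (u (w m)).1 fun i => x i m
  rw [← Fintype.prod_fiberwise w]
  refine Finset.prod_congr rfl fun j _ => ?_
  rw [← Equiv.prod_comp (σ j)]
  refine Finset.prod_congr rfl fun a _ => ?_
  have : ∀ q : {m // w m = j}, ((u j).1 fun i => (q.2 ▸ x i q.1 : (H j).ι i)) =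
      (u (w q.1)).1 fun i => x i q.1 := by
    rintro ⟨m, rfl⟩; rfl
  exact this (σ j a)

/-- The approximations of `u^{⊗ n}` exist for all `n` if a constant is added to the bound on `E`. -/
theorem MemFsub.exists_approx_all (hk : 1 ≤ k) {E : EntMeasure k} (hE : MemFsub E)
    {H : Space k} (u : H.Sphere) {s ε : ℝ} (hε : 0 < ε) (hs : smoothingLimit E H u < s) :
    ∃ C : ℝ, ∀ n : ℕ, ∃ χ : (H.pow n).Sphere,
      ‖χ.1 - (tpow u n).1‖ ^ 2 ≤ ε ∧ E _ χ ≤ n * s + C := by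
  obtain ⟨n₀, hn₀⟩ := Filter.eventually_atTop.mp
    ((hE.smoothingLimit_le_iff hk H u _).mp le_rfl ε hε s hs)
  have hs0 : 0 < s := (hE.smoothingLimit_nonneg hk H u).trans_lt hs
  have hC : 0 ≤ ∑ n ∈ Finset.range n₀, E _ (tpow u n) :=
    Finset.sum_nonneg fun n _ => hE.nonneg _ _
  refine ⟨∑ n ∈ Finset.range n₀, E _ (tpow u n), fun n => ?_⟩
  by_cases hn : n₀ ≤ n
  · obtain ⟨χ, h1, h2⟩ := hn₀ n hn
    exact ⟨χ, h1, by linarith⟩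
  · refine ⟨tpow u n, by simpa using hε.le, ?_⟩
    have h1 := Finset.single_le_sum (f := fun n => E _ (tpow u n)) (fun n _ => hE.nonneg _ _)
      (Finset.mem_range.mpr (not_le.mp hn))
    have h2 : (0 : ℝ) ≤ n * s := by positivity
    linarith

/-- The products `⨂ₘ u (w m)` can be approximated, uniformly over all words `w`, at a rate that
exceeds the smoothing limit of every letter. -/
theorem MemFsub.exists_approx_prod (hk : 1 ≤ k) {E : EntMeasure k} (hE : MemFsub E)
    {l : ℕ} {H : Fin l → Space k} (u : ∀ j, (H j).Sphere) {s ε : ℝ} (hε : 0 < ε)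
    (hs : ∀ j, smoothingLimit E (H j) (u j) < s) :
    ∃ C : ℝ, ∀ (n : ℕ) (w : Fin n → Fin l), ∃ χ : (Space.pi fun m => H (w m)).Sphere,
      ‖χ.1 - (prod fun m => u (w m)).1‖ ^ 2 ≤ ε ∧ E _ χ ≤ n * s + C := by
  -- Up to `l` overlaps of size `1 - κ` are multiplied; the final distance is twice their defect.
  set κ := min (ε / (2 * (l + 1))) 1 with hκ
  have hκ0 : 0 < κ := lt_min (by positivity) one_pos
  have hκ1 : κ ≤ 1 := min_le_right _ _
  have hκε : 2 * (l * κ) ≤ ε := by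
    have h1 : κ ≤ ε / (2 * (l + 1)) := min_le_left _ _
    rw [le_div_iff₀ (by positivity)] at h1
    nlinarith
  choose C hC using fun j => hE.exists_approx_all hk (u j) hκ0 (hs j)
  choose χ hχ hEχ using hC
  obtain ⟨c₀, hc₀⟩ := hE.prod_le hk
  refine ⟨c₀ + ∑ j, C j, fun n w => ?_⟩
  let c : Fin l → ℕ := fun j => Fintype.card {m // w m = j}
  let σ : ∀ j, Fin (c j) ≃ {m // w m = j} := fun j => (Fintype.equivFin _).symm
  have hcsum : ∑ j, (c j : ℝ) = n := by
    have : ∑ j, c j = n := by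
      rw [← Fintype.card_sigma, Fintype.card_congr (Equiv.sigmaFiberEquiv w), Fintype.card_fin]
    exact_mod_cast this
  set η := relabel (groupEquiv H w σ) (prod fun j => χ j (c j)) with hη
  have hEη : E _ η ≤ n * s + (c₀ + ∑ j, C j) := by
    calc _ ≤ E _ (prod fun j => χ j (c j)) := hE.relabel_le hk _ _
      _ ≤ c₀ + ∑ j, E _ (χ j (c j)) := hc₀ _
      _ ≤ c₀ + ∑ j, (c j * s + C j) := by
          gcongr with j
          exact hEχ j (c j)
      _ = _ := by rw [Finset.sum_add_distrib, ← Finset.sum_mul, hcsum]; ring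
  have hin : inner ℂ η.1 (prod fun m => u (w m)).1 =
      ∏ j, inner ℂ (χ j (c j)).1 (tpow (u j) (c j)).1 := by
    rw [← relabel_groupEquiv w σ u, hη, relabel_val, relabel_val, LinearIsometryEquiv.inner_map_map]
    exact inner_prodVec _ _
  have hge : 1 - l * κ ≤ ‖inner ℂ η.1 (prod fun m => u (w m)).1‖ ^ 2 := by
    rw [hin, norm_prod, ← Finset.prod_pow]
    calc 1 - l * κ ≤ (1 - κ) ^ l := by
          have := one_add_mul_le_pow (a := -κ) (by linarith) l
          simpa [sub_eq_add_neg] using this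
      _ = ∏ j : Fin l, (1 - κ) := by simp
      _ ≤ _ := Finset.prod_le_prod (fun j _ => by linarith) fun j _ =>
          one_sub_le_norm_inner_sq (hχ j (c j))
  obtain ⟨z, hz, hz'⟩ := exists_phase η (prod fun m => u (w m))
  exact ⟨phase z hz η, by linarith, (hE.phase_le z hz η).trans hEη⟩

/-! ### Logarithmic boundedness -/

theorem normalize_smul {H : Space k} {a : ℝ} (ha : 0 < a) (χ : H.Sphere)
    (h : (a : ℂ) • χ.1 ≠ 0) : normalize ((a : ℂ) • χ.1) h = χ := by
  apply Subtype.ext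
  have : (a : ℂ) ≠ 0 := by exact_mod_cast ha.ne'
  have hn : ‖(a : ℂ) • χ.1‖ = a := by simp [norm_smul, χ.2, abs_of_pos ha]
  change ((‖(a : ℂ) • χ.1‖ : ℂ)⁻¹) • (a : ℂ) • χ.1 = χ.1
  rw [hn, smul_smul, inv_mul_cancel₀ this, one_smul]

theorem MemFsub.logBounded_smoothingLimit (hk : 1 ≤ k) {E : EntMeasure k} (hE : MemFsub E) :
    LogBounded (smoothingLimit E) := by
  intro l H ψ hψ hunit
  set u := fun j => normalize (ψ j) (hψ j) with hu
  set b := ⨆ j, smoothingLimit E (H j) (u j) with hb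
  set Ψ : (Space.directSum H).Sphere := ⟨directSumVec ψ, hunit⟩ with hΨ
  have hl : 0 < l := by
    rcases Nat.eq_zero_or_pos l with rfl | h
    · have := norm_sq_directSumVec hk ψ
      rw [hunit] at this
      simp at this
    · exact h
  have hle : ∀ j, smoothingLimit E (H j) (u j) ≤ b := fun j =>
    le_ciSup (f := fun j => smoothingLimit E (H j) (u j)) (Set.finite_range _).bddAbove j
  rw [hE.smoothingLimit_le_iff hk]
  intro ε hε s hs
  obtain ⟨s', hs', hs's⟩ := exists_between (lt_sub_iff_add_lt.mpr hs)
  obtain ⟨C, hC⟩ := hE.exists_approx_prod hk u hε fun j => (hle j).trans_lt hs'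
  obtain ⟨n₀, hn₀⟩ := exists_nat_gt (C / (s - Real.logb 2 l - s'))
  filter_upwards [Filter.eventually_ge_atTop n₀] with n hn
  let word : Fin (l ^ n) → Fin n → Fin l := fun t => finFunctionFinEquiv.symm t
  choose χ hχ hEχ using fun t => hC n (word t)
  -- The summand of `Ψ^{⊗ n}` that belongs to the word `t` has norm `a t`.
  let a : Fin (l ^ n) → ℝ := fun t => ∏ m, ‖ψ (word t m)‖
  have ha : ∀ t, 0 < a t := fun t => Finset.prod_pos fun m _ => norm_pos_iff.mpr (hψ _)
  have hsummand : ∀ t, (prodVec fun m => ψ (word t m)) =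
      (a t : ℂ) • (prod fun m => u (word t m)).1 := fun t => by
    have := prodVec_smul (fun m => (‖ψ (word t m)‖ : ℂ)) fun m => (u (word t m)).1
    simp only [hu, norm_smul_normalize] at this
    refine this.trans ?_
    rw [← Complex.ofReal_prod]
    rfl
  have hpow := relabelVec_wordEquiv hk ψ n
  have hasum : ∑ t, a t ^ 2 = 1 := by
    have h1 := norm_sq_directSumVec hk fun t => prodVec fun m => ψ (word t m)
    have h2 : ‖directSumVec fun t => prodVec fun m => ψ (word t m)‖ = 1 := by
      rw [← LinearIsometryEquiv.norm_map (relabelVec (wordEquiv H n)), hpow, norm_powVec, hunit,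
        one_pow]
    rw [h2] at h1
    simpa [a, norm_prodVec] using h1.symm
  have hβ : ∀ t, (a t : ℂ) • (χ t).1 ≠ 0 := fun t h0 => by
    have := congrArg norm h0
    rw [norm_smul, (χ t).2, Complex.norm_real, norm_zero, mul_one, norm_eq_zero] at this
    exact (ha t).ne' this
  have hβunit : ‖directSumVec fun t => (a t : ℂ) • (χ t).1‖ = 1 := by
    have h1 := norm_sq_directSumVec hk fun t => (a t : ℂ) • (χ t).1
    simp only [norm_smul, (χ _).2, Complex.norm_real, mul_one, Real.norm_eq_abs, sq_abs,
      hasum] at h1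
    exact (pow_eq_one_iff_of_nonneg (norm_nonneg _) two_ne_zero).mp h1
  have hlog := hE.logBounded _ _ _ hβ hβunit
  simp only [normalize_smul (ha _)] at hlog
  refine ⟨relabel (wordEquiv H n) ⟨_, hβunit⟩, ?_, (hE.relabel_le hk _ _).trans (hlog.trans ?_)⟩
  · have h1 : (tpow Ψ n).1 = relabelVec (wordEquiv H n) (directSumVec fun t =>
        prodVec fun m => ψ (word t m)) := hpow.symm
    rw [h1, relabel_val, ← map_sub, LinearIsometryEquiv.norm_map, norm_sq_directSumVec_sub hk]
    calc _ = ∑ t, a t ^ 2 * ‖(χ t).1 - (prod fun m => u (word t m)).1‖ ^ 2 := by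
          refine Finset.sum_congr rfl fun t _ => ?_
          rw [hsummand, ← smul_sub, norm_smul, Complex.norm_real, mul_pow, Real.norm_eq_abs, sq_abs]
      _ ≤ ∑ t, a t ^ 2 * ε := Finset.sum_le_sum fun t _ =>
          mul_le_mul_of_nonneg_left (hχ t) (sq_nonneg _)
      _ = ε := by rw [← Finset.sum_mul, hasum, one_mul]
  · have : Nonempty (Fin (l ^ n)) := ⟨⟨0, by positivity⟩⟩
    have h1 : (⨆ t, E _ (χ t)) ≤ n * s' + C := ciSup_le hEχ
    have hd : 0 < s - Real.logb 2 l - s' := by linarith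
    have h2 : C ≤ n * (s - Real.logb 2 l - s') := by
      have := hn₀.le.trans (by exact_mod_cast hn : (n₀ : ℝ) ≤ n)
      rwa [div_le_iff₀ hd] at this
    have h3 : Real.logb 2 ((l ^ n : ℕ) : ℝ) = n * Real.logb 2 l := by
      push_cast
      exact Real.logb_pow _ _ _
    rw [h3]
    linarith

end Multipartite

end

theorem mainTheorem5 (k : ℕ) (hk : 1 ≤ k) (E : Multipartite.EntMeasure k)
    (hE : Multipartite.MemFsub E) :
    Multipartite.LogBounded (Multipartite.smoothingLimit E) ∧
    Multipartite.WeaklyMonotone (Multipartite.smoothingLimit E) ∧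
    (Multipartite.Additive (Multipartite.smoothingLimit E) →
      Multipartite.MonotoneOnAverage (Multipartite.smoothingLimit E)) :=
  ⟨hE.logBounded_smoothingLimit hk, hE.weaklyMonotone_smoothingLimit hk,
    hE.monotoneOnAverage_smoothingLimit hk⟩
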